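/- Let $n\ge 1$, $1<q<\infty$, $B_1,B_2>0$ and $0<\beta_0<\tfrac12$. There exists a constant $C$ depending only on $n,q,B_1,B_2$ and $\beta_0$ such that the following holds. Let $\Omega:\mathbb{R}^n\to\mathbb{R}$ satisfy, for all $r>0$ and $x\in\mathbb{R}^n\setminus\{0\}$, $$|\Omega(x)|\le B_1,\qquad \Omega(rx)=\Omega(x),\qquad \int_{\{|x|=1\}}\Omega\,d\sigma=0,\qquad \int_0^1\frac{\omega(\delta)}{\delta}\,d\delta\le B_2,$$ where $\sigma$ is the surface measure on the unit sphere and $\omega(\delta)=\sup\{|\Omega(x)-\Omega(x')|:\ |x-x'|\le\delta,\ |x|=|x'|=1\}$. Let $\chi\in C_0^\infty(\mathbb{R})$ be real-valued with $\chi(s)=1$ for $|s|\le1$, $\chi(s)=0$ for $|s|\ge2$ and $|\chi'|\le2$. Let $0<\beta\le 1-\beta_0$, $\varepsilon>0$, and let $f\in L^1(\mathbb{R}^n)\cap L^q(\mathbb{R}^n)$ be real-valued. Then the integral $$T_1f(x)=\int_{|y|\ge\varepsilon}\frac{\Omega(y)}{|y|^{n-\beta}}\,\chi(\beta|y|)\,f(x-y)\,dy$$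 converges absolutely for every $x\in\mathbb{R}^n$, $T_1f\in L^q(\mathbb{R}^n)$, and $$\|T_1f\|_q\le C\,\|f\|_q .$$ In particular, $C$ does not depend on $\beta$, $\varepsilon$, $\Omega$, $\chi$ or $f$ (beyond the stated parameters). -/

import Mathlib

open MeasureTheory
open scoped ENNReal NNReal ContDiff

/-- The modulus of continuity of `Ω` on the unit sphere,
`ω(δ) = sup {|Ω x - Ω x'| : |x - x'| ≤ δ, |x| = |x'| = 1}`, as an extended nonnegative number
(so that the supremum never takes a default value). -/
noncomputable def sphereModulus {n : ℕ} (Ω : EuclideanSpace ℝ (Fin n) → ℝ) (δ : ℝ) : ℝ≥0∞ :=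
  ⨆ (x : EuclideanSpace ℝ (Fin n)) (x' : EuclideanSpace ℝ (Fin n))
    (_ : ‖x‖ = 1) (_ : ‖x'‖ = 1) (_ : ‖x - x'‖ ≤ δ), ENNReal.ofReal |Ω x - Ω x'|

/-- `Ω` is bounded by `B₁`, homogeneous of degree `0`, has mean zero on the unit sphere with
respect to surface measure, and is Dini continuous there with Dini constant at most `B₂`. -/
structure IsDiniAngular {n : ℕ} (B₁ B₂ : ℝ) (Ω : EuclideanSpace ℝ (Fin n) → ℝ) : Prop where
  bounded : ∀ x, x ≠ 0 → |Ω x| ≤ B₁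
  homogeneous : ∀ r : ℝ, 0 < r → ∀ x, x ≠ 0 → Ω (r • x) = Ω x
  cancellation :
    ∫ x : Metric.sphere (0 : EuclideanSpace ℝ (Fin n)) 1, Ω x
      ∂((volume : Measure (EuclideanSpace ℝ (Fin n))).toSphere) = 0
  dini : ∫⁻ δ in Set.Ioo (0 : ℝ) 1, sphereModulus Ω δ / ENNReal.ofReal δ ≤ ENNReal.ofReal B₂

/-- A smooth cut-off function on the line: `χ = 1` on `[-1, 1]`, `χ = 0` outside `(-2, 2)`,
`|χ'| ≤ 2`. -/
structure IsCutoff (χ : ℝ → ℝ) : Prop where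
  smooth : ContDiff ℝ ∞ χ
  eq_one : ∀ s, |s| ≤ 1 → χ s = 1
  eq_zero : ∀ s, 2 ≤ |s| → χ s = 0
  deriv_le : ∀ s, |deriv χ s| ≤ 2

/-- The kernel `Ω(y) / |y|^(n-β) * χ(β|y|)`. -/
noncomputable def nearKernel {n : ℕ} (Ω : EuclideanSpace ℝ (Fin n) → ℝ) (χ : ℝ → ℝ) (β : ℝ)
    (y : EuclideanSpace ℝ (Fin n)) : ℝ :=
  Ω y / ‖y‖ ^ ((n : ℝ) - β) * χ (β * ‖y‖)

/-- The near-origin part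
`T₁ f(x) = ∫_{|y| ≥ ε} Ω(y) / |y|^(n-β) * χ(β|y|) * f(x - y) dy`. -/
noncomputable def nearPart {n : ℕ} (Ω : EuclideanSpace ℝ (Fin n) → ℝ) (χ : ℝ → ℝ) (β ε : ℝ)
    (f : EuclideanSpace ℝ (Fin n) → ℝ) (x : EuclideanSpace ℝ (Fin n)) : ℝ :=
  ∫ y in {y | ε ≤ ‖y‖}, nearKernel Ω χ β y * f (x - y)

/-! On the support of the cutoff `β * |y| ≤ 2`, so for `0 < β ≤ 1` the factor `|y| ^ β` is at most
`(2 / β) ^ β ≤ 2e < 6` (`rpow_self_le_six`). Hence the kernel has size `C / |y| ^ n` and radial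
derivative of size `C / |y| ^ (n + 1)`, uniformly in `β`: it is a truncated singular integral kernel
of Calderón–Zygmund type.

Two uniform facts about this kernel are needed. Hörmander's condition follows by splitting a
difference of kernel values into an angular part, paid for by the Dini integral, a smooth radial
part, and the jump at radius `ε`, which is seen only for radii comparable to `ε`. The Fourier
transform at `ξ` is bounded by cutting the kernel at `|x| = 1 / |ξ|`: inside, the mean value zero of
`Ω` gains a factor `|x| |ξ|`; outside, translation by half a period reduces the integral to
Hörmander's condition.

From there the argument is the classical one: Plancherel gives `L²`, the dyadic Calderón–Zygmund
decomposition gives weak type `(1, 1)`, Marcinkiewicz interpolation gives `1 < p < 2`, and duality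
gives `q > 2`. Since `ε > 0` and `χ` has compact support, the kernel is bounded and integrable;
these bounds depend on `ε` and `β`, but they serve only to make integrals converge and never enter
the final constant, which is built from `kernelConst`. -/

/-! ### Plancherel's theorem for the Fourier integral. -/

section Plancherel

open FourierTransform SchwartzMap

variable {V : Type*} [NormedAddCommGroup V] [InnerProductSpace ℝ V] [FiniteDimensional ℝ V]
  [MeasurableSpace V] [BorelSpace V]

/-- On `L¹ ∩ L²` the `L²` Fourier transform is given by the Fourier integral. -/
theorem fourier_toLp_ae_eq {f : V → ℂ} (hf : Integrable f) (hf2 : MemLp f 2) :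
    (𝓕 (hf2.toLp f) : Lp (α := V) ℂ 2) =ᵐ[volume] 𝓕 f := by
  have hcont : Continuous (𝓕 f) :=
    VectorFourier.fourierIntegral_continuous Real.continuous_fourierChar
      (L := innerₗ V) continuous_inner hf
  refine ae_eq_of_integral_contDiff_smul_eq
    ((Lp.memLp _).locallyIntegrable (by norm_num)) hcont.locallyIntegrable ?_
  intro g hg hgc
  have hg₁ : HasCompactSupport (Complex.ofRealCLM ∘ g) := hgc.comp_left rfl
  have hg₂ : ContDiff ℝ ∞ (Complex.ofRealCLM ∘ g) := by fun_prop
  set G : 𝓢(V, ℂ) := hg₁.toSchwartzMap hg₂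
  have hG : ∀ x, G x = (g x : ℂ) := fun x => rfl
  -- The `L²` transform is also the distributional one, so testing it against `G` moves the
  -- transform onto `G`; `h2` moves it back onto `f` as a Fourier integral.
  have h1 := congrArg (fun T : 𝓢'(V, ℂ) => T G)
    (Lp.fourier_toTemperedDistribution_eq (hf2.toLp f))
  simp only [TemperedDistribution.fourier_apply, Lp.toTemperedDistribution_apply] at h1
  have h2 : ∫ x, 𝓕 (G : V → ℂ) x • f x = ∫ x, G x • 𝓕 f x := by
    have := VectorFourier.integral_fourierIntegral_smul_eq_flip (L := innerₗ V)
      Real.continuous_fourierChar continuous_inner (μ := volume) (ν := volume) G.integrable hf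
    rw [flip_innerₗ] at this
    exact this
  calc ∫ x, g x • (𝓕 (hf2.toLp f) : Lp (α := V) ℂ 2 volume) x
      = ∫ x, G x • (𝓕 (hf2.toLp f) : Lp (α := V) ℂ 2 volume) x := by
        simp [hG]
    _ = ∫ x, (𝓕 (G : V → ℂ)) x • (hf2.toLp f) x := h1.symm
    _ = ∫ x, (𝓕 (G : V → ℂ)) x • f x := by
        refine integral_congr_ae ?_
        filter_upwards [hf2.coeFn_toLp] with x hx
        rw [hx]
    _ = ∫ x, G x • 𝓕 f x := h2
    _ = ∫ x, g x • 𝓕 f x := by simp [hG]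

/-- Plancherel's theorem for the Fourier integral on `L¹ ∩ L²`. -/
theorem eLpNorm_fourier_eq {f : V → ℂ} (hf : Integrable f) (hf2 : MemLp f 2) :
    eLpNorm (𝓕 f) 2 volume = eLpNorm f 2 volume := by
  rw [← eLpNorm_congr_ae (fourier_toLp_ae_eq hf hf2), ← eLpNorm_congr_ae hf2.coeFn_toLp,
    ← Lp.enorm_def, ← Lp.enorm_def]
  simp only [enorm_eq_nnnorm]
  congr 1
  exact NNReal.eq (Lp.norm_fourier_eq _)

end Plancherel

/-! ### Convolution and the `L²` bound. -/

section Convolution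

open FourierTransform

variable {V : Type*} [NormedAddCommGroup V] [InnerProductSpace ℝ V] [FiniteDimensional ℝ V]
  [MeasurableSpace V] [BorelSpace V]

/-- Convolution of real functions against the volume. -/
noncomputable def realConv (K f : V → ℝ) (x : V) : ℝ := ∫ y, K y * f (x - y)

theorem realConv_eq_swap (K f : V → ℝ) (x : V) : realConv K f x = ∫ y, K (x - y) * f y := by
  rw [realConv, ← integral_sub_left_eq_self (fun y => K y * f (x - y)) volume x]
  simp

theorem realConv_eq_convolution (K f : V → ℝ) :
    realConv K f = convolution K f (ContinuousLinearMap.mul ℝ ℝ) volume := by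
  ext x; simp [realConv, convolution]

theorem ofReal_realConv (K f : V → ℝ) (x : V) : (realConv K f x : ℂ) =
    convolution (fun y => (K y : ℂ)) (fun y => (f y : ℂ)) (ContinuousLinearMap.mul ℂ ℂ)
      volume x := by
  simp only [realConv, convolution, ContinuousLinearMap.mul_apply']
  rw [← integral_complex_ofReal]
  simp

theorem integrable_realConv {K f : V → ℝ} (hK : Integrable K) (hf : Integrable f) :
    Integrable (realConv K f) := by
  rw [realConv_eq_convolution]
  exact hK.integrable_convolution _ hf

theorem integrable_realConv_integrand {K f : V → ℝ} {M : ℝ} (hK : Measurable K)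
    (hM : ∀ x, |K x| ≤ M) (hf : Integrable f) (x : V) : Integrable (fun y => K y * f (x - y)) :=
  (hf.comp_sub_left x).bdd_mul hK.aestronglyMeasurable (Filter.Eventually.of_forall hM)

theorem abs_realConv_le {K f : V → ℝ} {M : ℝ}
    (hM : ∀ x, |K x| ≤ M) (hf : Integrable f) (x : V) :
    |realConv K f x| ≤ M * ∫ y, |f y| := by
  rw [← integral_sub_left_eq_self (fun y => |f y|) volume x, ← integral_const_mul, realConv,
    ← Real.norm_eq_abs]
  refine norm_integral_le_of_norm_le ((hf.abs.comp_sub_left x).const_mul M) ?_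
  refine Filter.Eventually.of_forall fun y => ?_
  rw [norm_mul]
  exact mul_le_mul_of_nonneg_right (hM y) (abs_nonneg _)

/-- Pointwise `|g| ^ p ≤ M ^ (p - 1) * |g|`. Both the `L²` norm of the good function and the
finiteness of `L^p` norms rest on it. -/
theorem lintegral_enorm_rpow_le_of_bounded {α : Type*} [MeasurableSpace α] {μ : Measure α}
    {g : α → ℝ} {M : ℝ} (hM : ∀ᵐ x ∂μ, |g x| ≤ M) {p : ℝ} (hp : 1 ≤ p) :
    ∫⁻ x, ‖g x‖ₑ ^ p ∂μ ≤ ENNReal.ofReal M ^ (p - 1) * ∫⁻ x, ‖g x‖ₑ ∂μ := by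
  rw [← lintegral_const_mul' _ _
    (ENNReal.rpow_ne_top_of_nonneg (by linarith) ENNReal.ofReal_ne_top)]
  refine lintegral_mono_ae ?_
  filter_upwards [hM] with x hx
  have h : ‖g x‖ₑ ^ p = ‖g x‖ₑ ^ (p - 1) * ‖g x‖ₑ := by
    conv_rhs => rw [← ENNReal.rpow_one ‖g x‖ₑ, ← ENNReal.rpow_mul, one_mul]
    rw [← ENNReal.rpow_add_of_nonneg _ _ (by linarith) zero_le_one]
    simp
  rw [h, Real.enorm_eq_ofReal_abs]
  gcongr

theorem memLp_of_integrable_of_bounded {α : Type*} [MeasurableSpace α] {μ : Measure α}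
    {g : α → ℝ} (hg : Integrable g μ) {M : ℝ} (hM : ∀ᵐ x ∂μ, |g x| ≤ M) {p : ℝ≥0∞} (hp : 1 ≤ p)
    (hp' : p ≠ ⊤) : MemLp g p μ := by
  refine ⟨hg.1, ?_⟩
  have hp1 : 1 ≤ p.toReal := by
    rw [← ENNReal.toReal_one]
    exact ENNReal.toReal_mono hp' hp
  rw [eLpNorm_lt_top_iff_lintegral_rpow_enorm_lt_top (by positivity) hp']
  refine (lintegral_enorm_rpow_le_of_bounded hM hp1).trans_lt ?_
  exact ENNReal.mul_lt_top (ENNReal.rpow_lt_top_of_nonneg (by linarith) ENNReal.ofReal_ne_top) hg.2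

/-- Purely qualitative: the implicit bound depends on `M`, hence on the truncation, and is not used
in any estimate. -/
theorem memLp_realConv {K f : V → ℝ} (hK : Integrable K) {M : ℝ} (hM : ∀ x, |K x| ≤ M)
    (hf : Integrable f) {p : ℝ≥0∞} (hp : 1 ≤ p)
    (hp' : p ≠ ⊤) : MemLp (realConv K f) p :=
  memLp_of_integrable_of_bounded (integrable_realConv hK hf)
    (Filter.Eventually.of_forall (abs_realConv_le hM hf)) hp hp'

/-- The Fourier transform turns the convolution into multiplication by a function bounded by `A`,
and Plancherel holds on both sides. -/
theorem eLpNorm_two_realConv_le {K f : V → ℝ} (hK : Integrable K) {M : ℝ} (hM : ∀ x, |K x| ≤ M)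
    {A : ℝ≥0} (hA : ∀ ξ, ‖𝓕 (fun x => (K x : ℂ)) ξ‖ ≤ A)
    (hf : Integrable f) (hf2 : MemLp f 2) :
    eLpNorm (realConv K f) 2 volume ≤ A * eLpNorm f 2 volume := by
  have hT := integrable_realConv hK hf
  have hT2 : MemLp (realConv K f) 2 := memLp_realConv hK hM hf (by norm_num) (by norm_num)
  have e1 : ∀ g : V → ℝ, eLpNorm (fun x => (g x : ℂ)) 2 volume = eLpNorm g 2 volume := fun g =>
    eLpNorm_congr_norm_ae (Filter.Eventually.of_forall fun x => by simp)
  have hT' : Integrable (fun x => (realConv K f x : ℂ)) := hT.ofReal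
  have hT2' : MemLp (fun x => (realConv K f x : ℂ)) 2 := hT2.ofReal
  have hf' : Integrable (fun x => (f x : ℂ)) := hf.ofReal
  have hf2' : MemLp (fun x => (f x : ℂ)) 2 := hf2.ofReal
  have hK' : Integrable (fun x => (K x : ℂ)) := hK.ofReal
  rw [← e1, ← e1 f, ← eLpNorm_fourier_eq hT' hT2', ← eLpNorm_fourier_eq hf' hf2']
  refine eLpNorm_le_nnreal_smul_eLpNorm_of_ae_le_mul (Filter.Eventually.of_forall fun ξ => ?_) _
  rw [funext (ofReal_realConv K f), Real.fourier_mul_convolution_eq hK' hf' ξ, nnnorm_mul]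
  gcongr
  exact hA ξ

end Convolution

/-! ### Dyadic cubes, stopping cubes and Lebesgue differentiation. -/

section Dyadic

variable {n : ℕ}

/-- The index of the dyadic cube of side `2 ^ k` that contains `x`. -/
noncomputable def dyadicIndex (k : ℤ) (x : EuclideanSpace ℝ (Fin n)) : Fin n → ℤ :=
  fun i => ⌊x i / 2 ^ k⌋

/-- The half-open dyadic cube of side `2 ^ k` with index `m`. -/
def dyadicCube (k : ℤ) (m : Fin n → ℤ) : Set (EuclideanSpace ℝ (Fin n)) :=
  {x | dyadicIndex k x = m}

theorem mem_dyadicCube {k : ℤ} {m : Fin n → ℤ} {x : EuclideanSpace ℝ (Fin n)} :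
    x ∈ dyadicCube k m ↔ dyadicIndex k x = m := Iff.rfl

theorem dyadicCube_eq (k : ℤ) (m : Fin n → ℤ) : dyadicCube k m =
    (WithLp.ofLp : EuclideanSpace ℝ (Fin n) → Fin n → ℝ) ⁻¹'
      (Set.univ.pi fun i => Set.Ico (m i * 2 ^ k : ℝ) ((m i + 1) * 2 ^ k)) := by
  have h2 : (0 : ℝ) < 2 ^ k := by positivity
  ext x
  simp only [dyadicCube, dyadicIndex, funext_iff, Int.floor_eq_iff, Set.mem_ofPred_eq,
    Set.mem_preimage, Set.mem_univ_pi, Set.mem_Ico, le_div_iff₀ h2, div_lt_iff₀ h2]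

theorem measurableSet_dyadicCube (k : ℤ) (m : Fin n → ℤ) : MeasurableSet (dyadicCube k m) := by
  rw [dyadicCube_eq]
  exact (PiLp.volume_preserving_ofLp _).measurable
    (MeasurableSet.univ_pi fun i => measurableSet_Ico)

theorem volume_dyadicCube (k : ℤ) (m : Fin n → ℤ) :
    volume (dyadicCube k m) = ENNReal.ofReal (2 ^ k) ^ n := by
  rw [dyadicCube_eq, (PiLp.volume_preserving_ofLp _).measure_preimage
    (MeasurableSet.univ_pi fun i => measurableSet_Ico).nullMeasurableSet, Real.volume_pi_Ico]
  simp [add_mul]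

theorem volume_dyadicCube_pos (k : ℤ) (m : Fin n → ℤ) : 0 < volume (dyadicCube k m) := by
  rw [volume_dyadicCube]
  exact ENNReal.pow_pos (ENNReal.ofReal_pos.2 (by positivity)) _

theorem volume_dyadicCube_ne_top (k : ℤ) (m : Fin n → ℤ) : volume (dyadicCube k m) ≠ ⊤ := by
  rw [volume_dyadicCube]
  exact ENNReal.pow_ne_top ENNReal.ofReal_ne_top

theorem norm_sub_le_of_mem_dyadicCube {k : ℤ} {m : Fin n → ℤ} {x y : EuclideanSpace ℝ (Fin n)}
    (hx : x ∈ dyadicCube k m) (hy : y ∈ dyadicCube k m) : ‖x - y‖ ≤ √n * 2 ^ k := by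
  have h2 : (0 : ℝ) < 2 ^ k := by positivity
  rw [dyadicCube_eq] at hx hy
  simp only [Set.mem_preimage, Set.mem_univ_pi, Set.mem_Ico] at hx hy
  have h : ∀ i, ‖(x - y) i‖ ^ 2 ≤ (2 ^ k : ℝ) ^ 2 := by
    intro i
    have h1 := hx i
    have h3 := hy i
    rw [Real.norm_eq_abs]
    gcongr
    rw [PiLp.sub_apply, abs_le]
    constructor <;> nlinarith
  rw [EuclideanSpace.norm_eq]
  calc √(∑ i, ‖(x - y) i‖ ^ 2) ≤ √(∑ _i : Fin n, (2 ^ k : ℝ) ^ 2) := by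
        exact Real.sqrt_le_sqrt (Finset.sum_le_sum fun i _ => h i)
    _ = √n * 2 ^ k := by
        rw [Finset.sum_const, Finset.card_univ, Fintype.card_fin, nsmul_eq_mul,
          Real.sqrt_mul (by positivity), Real.sqrt_sq h2.le]

/-- The coarse index is the integer quotient of the fine one by `2 ^ j`, so it is determined by it.
This is the nesting of dyadic cubes. -/
theorem dyadicIndex_eq_of_le {k l : ℤ} (hkl : k ≤ l) {x y : EuclideanSpace ℝ (Fin n)}
    (h : dyadicIndex k x = dyadicIndex k y) : dyadicIndex l x = dyadicIndex l y := by
  obtain ⟨j, rfl⟩ := Int.le.dest hkl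
  have key : ∀ t : ℝ, ⌊t / 2 ^ (k + (j : ℤ))⌋ = ⌊t / 2 ^ k⌋ / ((2 ^ j : ℕ) : ℤ) := by
    intro t
    rw [← Int.floor_div_natCast, zpow_add₀ two_ne_zero, zpow_natCast, div_div]
    push_cast
    rfl
  ext i
  have hi := congrFun h i
  simp only [dyadicIndex] at hi ⊢
  rw [key, key, hi]

theorem dyadicCube_subset_of_le {k l : ℤ} (hkl : k ≤ l) {m p : Fin n → ℤ}
    (h : (dyadicCube k m ∩ dyadicCube l p).Nonempty) : dyadicCube k m ⊆ dyadicCube l p := by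
  obtain ⟨z, hz, hz'⟩ := h
  intro x hx
  rw [mem_dyadicCube] at *
  rw [← hz']
  exact dyadicIndex_eq_of_le hkl (hx.trans hz.symm)

/-- The dyadic cubes on which the average of `F` exceeds `a`, maximal with that property. -/
def maximalDyadicCubes (F : EuclideanSpace ℝ (Fin n) → ℝ≥0∞) (a : ℝ≥0∞) :
    Set (ℤ × (Fin n → ℤ)) :=
  {p | a * volume (dyadicCube p.1 p.2) < ∫⁻ x in dyadicCube p.1 p.2, F x ∧
    ∀ l m, p.1 < l → (dyadicCube p.1 p.2 ∩ dyadicCube l m).Nonempty →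
      ∫⁻ x in dyadicCube l m, F x ≤ a * volume (dyadicCube l m)}

variable {F : EuclideanSpace ℝ (Fin n) → ℝ≥0∞} {a : ℝ≥0∞}

/-- If two of the cubes meet at different scales, maximality of the smaller one says that the larger
is not selected; at equal scales a common point forces equal indices. -/
theorem maximalDyadicCubes_disjoint {p q : ℤ × (Fin n → ℤ)} (hp : p ∈ maximalDyadicCubes F a)
    (hq : q ∈ maximalDyadicCubes F a) (hpq : p ≠ q) :
    Disjoint (dyadicCube p.1 p.2) (dyadicCube q.1 q.2) := by
  rw [Set.disjoint_iff_inter_eq_empty]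
  by_contra hne
  rw [← ne_eq, ← Set.nonempty_iff_ne_empty] at hne
  rcases lt_trichotomy p.1 q.1 with h | h | h
  · exact absurd hq.1 (not_lt.2 (hp.2 _ _ h hne))
  · obtain ⟨z, hz, hz'⟩ := hne
    rw [mem_dyadicCube] at hz hz'
    exact hpq (Prod.ext h (by rw [← hz, ← hz', h]))
  · exact absurd hp.1 (not_lt.2 (hq.2 _ _ h (by rwa [Set.inter_comm])))

/-- A selected cube has volume below `(∫ F) / a`, so the scales of selected cubes around `x` are
bounded above and there is a largest one. Positive dimension makes the volume grow with the scale.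
-/
theorem exists_maximalDyadicCube [NeZero n] (ha : a ≠ 0) (hF : ∫⁻ x, F x ≠ ⊤) {k : ℤ}
    {m : Fin n → ℤ} (h : a * volume (dyadicCube k m) < ∫⁻ x in dyadicCube k m, F x)
    {x : EuclideanSpace ℝ (Fin n)} (hx : x ∈ dyadicCube k m) :
    ∃ p ∈ maximalDyadicCubes F a, x ∈ dyadicCube p.1 p.2 := by
  have hbdd : ∃ b : ℤ, ∀ l : ℤ, a * volume (dyadicCube l (dyadicIndex l x)) <
      ∫⁻ y in dyadicCube l (dyadicIndex l x), F y → l ≤ b := by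
    have hlim : Filter.Tendsto (fun N : ℕ => ENNReal.ofReal (2 ^ (N : ℤ))) Filter.atTop
        (nhds ⊤) := by
      refine ENNReal.tendsto_ofReal_atTop.comp ?_
      simpa using tendsto_pow_atTop_atTop_of_one_lt (one_lt_two : (1 : ℝ) < 2)
    have hc : (∫⁻ x, F x) / a < ⊤ := ENNReal.div_lt_top hF ha
    obtain ⟨N, hN, hN1⟩ := ((hlim.eventually (lt_mem_nhds hc)).and
      (Filter.eventually_ge_atTop 0)).exists
    refine ⟨N, fun l hl => ?_⟩
    by_contra! hlt
    have h1 : (1 : ℝ≥0∞) ≤ ENNReal.ofReal (2 ^ l) := by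
      rw [ENNReal.one_le_ofReal]
      exact one_le_zpow₀ one_le_two (by omega)
    have h2 : (∫⁻ x, F x) / a ≤ volume (dyadicCube l (dyadicIndex l x)) := by
      rw [volume_dyadicCube]
      calc (∫⁻ x, F x) / a ≤ ENNReal.ofReal (2 ^ (N : ℤ)) := hN.le
        _ ≤ ENNReal.ofReal (2 ^ l) :=
          ENNReal.ofReal_le_ofReal (zpow_le_zpow_right₀ one_le_two hlt.le)
        _ ≤ _ := le_self_pow h1 (NeZero.ne n)
    refine absurd hl (not_lt.2 ((setLIntegral_le_lintegral _ _).trans ?_))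
    have := mul_le_mul_right h2 a
    refine le_trans ?_ this
    rw [ENNReal.mul_div_cancel' (fun h => absurd h ha)]
    -- The remaining case `a = ⊤` is impossible, as no integral exceeds `⊤`.
    rintro rfl
    rw [ENNReal.top_mul (volume_dyadicCube_pos _ _).ne'] at hl
    exact absurd hl not_top_lt
  obtain ⟨l, hl, hmax⟩ := Int.exists_greatest_of_bdd hbdd ⟨k, by rwa [mem_dyadicCube.1 hx]⟩
  refine ⟨(l, dyadicIndex l x), ⟨hl, fun l' m' hl' hne => ?_⟩, rfl⟩
  have hsub := dyadicCube_subset_of_le (le_of_lt hl') hne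
  have hx' : x ∈ dyadicCube l' m' := hsub rfl
  rw [mem_dyadicCube] at hx'
  subst hx'
  by_contra! hlt
  exact absurd (hmax l' hlt) (not_le.2 hl')

/-- The parent cube is not selected, and its volume is `2 ^ n` times larger. -/
theorem lintegral_maximalDyadicCube_le {p : ℤ × (Fin n → ℤ)} (hp : p ∈ maximalDyadicCubes F a) :
    ∫⁻ x in dyadicCube p.1 p.2, F x ≤ 2 ^ n * a * volume (dyadicCube p.1 p.2) := by
  obtain ⟨z, hz⟩ := nonempty_of_measure_ne_zero (volume_dyadicCube_pos p.1 p.2).ne'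
  have hne : (dyadicCube p.1 p.2 ∩ dyadicCube (p.1 + 1) (dyadicIndex (p.1 + 1) z)).Nonempty :=
    ⟨z, hz, rfl⟩
  calc ∫⁻ x in dyadicCube p.1 p.2, F x
      ≤ ∫⁻ x in dyadicCube (p.1 + 1) (dyadicIndex (p.1 + 1) z), F x :=
        lintegral_mono_set (dyadicCube_subset_of_le (by omega) hne)
    _ ≤ a * volume (dyadicCube (p.1 + 1) (dyadicIndex (p.1 + 1) z)) :=
        hp.2 _ _ (by omega) hne
    _ = 2 ^ n * a * volume (dyadicCube p.1 p.2) := by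
        rw [volume_dyadicCube, volume_dyadicCube, zpow_add₀ two_ne_zero, mul_comm (2 ^ p.1 : ℝ),
          ENNReal.ofReal_mul (by positivity), mul_pow]
        simp
        ring

/-- Lebesgue differentiation along dyadic cubes: a bound for all averages of `|f|` over the dyadic
cubes around `x` bounds `|f x|`, for almost every `x`. -/
theorem ae_abs_le_of_dyadic_average_le [NeZero n] {f : EuclideanSpace ℝ (Fin n) → ℝ}
    (hf : Integrable f) {t : ℝ} (ht : 0 ≤ t) :
    ∀ᵐ x, (∀ k, ∫⁻ y in dyadicCube k (dyadicIndex k x), ‖f y‖ₑ ≤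
      ENNReal.ofReal t * volume (dyadicCube k (dyadicIndex k x))) → |f x| ≤ t := by
  have hn : (0 : ℝ) < √n := Real.sqrt_pos.2 (by exact_mod_cast Nat.pos_of_ne_zero (NeZero.ne n))
  filter_upwards [IsUnifLocDoublingMeasure.ae_tendsto_average_norm_sub volume
    hf.locallyIntegrable 1] with x hx h
  have hδ0 : Filter.Tendsto (fun j : ℕ => √n * (2 : ℝ) ^ (-(j : ℤ))) Filter.atTop (nhds 0) := by
    have := (tendsto_pow_atTop_nhds_zero_of_lt_one (r := (1 / 2 : ℝ)) (by norm_num)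
      (by norm_num)).const_mul √n
    simpa using this
  have hδ : Filter.Tendsto (fun j : ℕ => √n * (2 : ℝ) ^ (-(j : ℤ))) Filter.atTop
      (nhdsWithin 0 (Set.Ioi 0)) :=
    tendsto_nhdsWithin_iff.2 ⟨hδ0, Filter.Eventually.of_forall fun j =>
      Set.mem_Ioi.2 (by positivity)⟩
  have hT := hx (fun _ => x) _ hδ (Filter.Eventually.of_forall fun j =>
    Metric.mem_closedBall_self (by positivity))
  set V : ℝ := volume.real (Metric.closedBall (0 : EuclideanSpace ℝ (Fin n)) 1)
  -- Each cube `Q` lies in a ball `B` about `x` of volume `√n ^ n * V` times that of `Q`. So `|f x|`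
  -- is at most `t` plus this ratio times the average of `|f - f x|` over `B`, which tends to `0`.
  have hT' := (hT.const_mul (√n ^ n * V)).const_add t
  rw [mul_zero, add_zero] at hT'
  refine ge_of_tendsto' hT' fun j => ?_
  set Q := dyadicCube (-(j : ℤ)) (dyadicIndex (-(j : ℤ)) x)
  set B := Metric.closedBall x (√n * (2 : ℝ) ^ (-(j : ℤ)))
  have hQB : Q ⊆ B := fun y hy => by
    rw [Metric.mem_closedBall, dist_eq_norm]
    exact norm_sub_le_of_mem_dyadicCube hy rfl
  have hv : volume.real Q = ((2 : ℝ) ^ (-(j : ℤ))) ^ n := by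
    rw [measureReal_def, volume_dyadicCube, ENNReal.toReal_pow,
      ENNReal.toReal_ofReal (by positivity)]
  have hvpos : 0 < volume.real Q := by rw [hv]; positivity
  have hB : volume.real B = volume.real Q * (√n ^ n * V) := by
    rw [measureReal_def, Measure.addHaar_closedBall' _ _ (by positivity), ENNReal.toReal_mul,
      ENNReal.toReal_ofReal (by positivity), hv, finrank_euclideanSpace_fin]
    simp only [V, measureReal_def]
    ring
  have hBpos : 0 < volume.real B := hvpos.trans_le (measureReal_mono hQB
    (measure_closedBall_lt_top).ne)
  have hQfin : volume Q ≠ ⊤ := volume_dyadicCube_ne_top _ _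
  have i1 : IntegrableOn (fun y => |f y|) Q := hf.abs.integrableOn
  have i2 : IntegrableOn (fun y => ‖f y - f x‖) B :=
    (hf.integrableOn.sub (integrableOn_const (measure_closedBall_lt_top).ne)).norm
  have e1 : ∫ y in Q, |f y| ≤ t * volume.real Q := by
    have h1 := h (-(j : ℤ))
    have : ENNReal.ofReal (∫ y in Q, |f y|) ≤ ENNReal.ofReal (t * volume.real Q) := by
      rw [ofReal_integral_eq_lintegral_ofReal i1
          (Filter.Eventually.of_forall fun y => abs_nonneg _),
        ENNReal.ofReal_mul ht, ofReal_measureReal hQfin]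
      simpa only [Real.enorm_eq_ofReal_abs] using h1
    exact (ENNReal.ofReal_le_ofReal_iff (by positivity)).1 this
  have e2 : ∫ y in Q, ‖f y - f x‖ ≤ volume.real B * ⨍ y in B, ‖f y - f x‖ := by
    have : volume.real B * ⨍ y in B, ‖f y - f x‖ = ∫ y in B, ‖f y - f x‖ := by
      rw [setAverage_eq, smul_eq_mul, mul_inv_cancel_left₀ hBpos.ne']
    rw [this]
    exact setIntegral_mono_set i2 (Filter.Eventually.of_forall fun y => norm_nonneg _)
      hQB.eventuallyLE
  have e3 : |f x| * volume.real Q ≤ ∫ y in Q, (|f y| + ‖f y - f x‖) := by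
    have : |f x| * volume.real Q = ∫ _y in Q, |f x| := by
      rw [setIntegral_const, smul_eq_mul, mul_comm]
    rw [this]
    refine setIntegral_mono (integrableOn_const hQfin) (i1.add (i2.mono_set hQB)) fun y => ?_
    have := abs_sub_abs_le_abs_sub (f x) (f y)
    rw [abs_sub_comm] at this
    simp only [Real.norm_eq_abs]
    linarith
  rw [integral_add i1 (i2.mono_set hQB)] at e3
  rw [hB] at e2
  have : |f x| * volume.real Q ≤ (t + √n ^ n * V * ⨍ y in B, ‖f y - f x‖) * volume.real Q := by
    nlinarith
  exact le_of_mul_le_mul_right this hvpos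

theorem ae_abs_le_of_notMem_maximalDyadicCubes [NeZero n] {f : EuclideanSpace ℝ (Fin n) → ℝ}
    (hf : Integrable f) {t : ℝ} (ht : 0 < t) :
    ∀ᵐ x, (∀ p ∈ maximalDyadicCubes (fun y => ‖f y‖ₑ) (ENNReal.ofReal t),
      x ∉ dyadicCube p.1 p.2) → |f x| ≤ t := by
  filter_upwards [ae_abs_le_of_dyadic_average_le hf ht.le] with x hx h
  refine hx fun k => ?_
  by_contra! hlt
  obtain ⟨p, hp, hxp⟩ := exists_maximalDyadicCube (ENNReal.ofReal_pos.2 ht).ne' hf.2.ne hlt rfl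
  exact h p hp hxp

end Dyadic

/-! ### Averaging over a disjoint family. -/

section Averaging

variable {α ι : Type*} [MeasurableSpace α] {μ : Measure α} {Q : ι → Set α} {f : α → ℝ}

open scoped Classical in
/-- The function that equals the average of `f` over `Q i` on `Q i`, and `f` off all `Q i`. -/
noncomputable def averageOn (μ : Measure α) (Q : ι → Set α) (f : α → ℝ) (x : α) : ℝ :=
  if h : ∃ i, x ∈ Q i then ⨍ y in Q h.choose, f y ∂μ else f x

/-- Disjointness makes the chosen index unique, so the choice in the definition is harmless. -/
theorem averageOn_of_mem (hd : Pairwise (Function.onFun Disjoint Q)) {i : ι} {x : α}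
    (hx : x ∈ Q i) : averageOn μ Q f x = ⨍ y in Q i, f y ∂μ := by
  have h : ∃ i, x ∈ Q i := ⟨i, hx⟩
  have : h.choose = i := by
    by_contra hne
    exact Set.disjoint_left.1 (hd hne) h.choose_spec hx
  rw [averageOn, dif_pos h, this]

theorem averageOn_of_notMem {x : α} (hx : x ∉ ⋃ i, Q i) : averageOn μ Q f x = f x := by
  rw [averageOn, dif_neg]
  simpa using hx

variable (hd : Pairwise (Function.onFun Disjoint Q)) (hm : ∀ i, MeasurableSet (Q i))
include hd hm

theorem setIntegral_averageOn (hfin : ∀ i, μ (Q i) ≠ ⊤) (i : ι) :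
    ∫ x in Q i, averageOn μ Q f x ∂μ = ∫ x in Q i, f x ∂μ := by
  rw [setIntegral_congr_fun (hm i) (fun x hx => averageOn_of_mem hd hx), setIntegral_const,
    measure_smul_setAverage _ (hfin i)]

theorem setLIntegral_enorm_averageOn_le (hfin : ∀ i, μ (Q i) ≠ ⊤) (i : ι) :
    ∫⁻ x in Q i, ‖averageOn μ Q f x‖ₑ ∂μ ≤ ∫⁻ x in Q i, ‖f x‖ₑ ∂μ := by
  rw [setLIntegral_congr_fun (hm i) (fun x hx => by rw [averageOn_of_mem hd hx]),
    setLIntegral_const]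
  refine le_trans (le_of_eq ?_) (enorm_integral_le_lintegral_enorm _)
  rw [← measure_smul_setAverage _ (hfin i), enorm_smul, mul_comm]
  congr 1
  rw [Real.enorm_eq_ofReal measureReal_nonneg, ofReal_measureReal (hfin i)]

theorem abs_averageOn_le_of_mem (hpos : ∀ i, μ (Q i) ≠ 0) (hfin : ∀ i, μ (Q i) ≠ ⊤) {M : ℝ}
    (hM : 0 ≤ M) (hQ : ∀ i, ∫⁻ x in Q i, ‖f x‖ₑ ∂μ ≤ ENNReal.ofReal M * μ (Q i)) {x : α}
    (hx : x ∈ ⋃ i, Q i) : |averageOn μ Q f x| ≤ M := by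
  obtain ⟨i, hi⟩ := Set.mem_iUnion.1 hx
  have h := (setLIntegral_enorm_averageOn_le (f := f) hd hm hfin i).trans (hQ i)
  rw [setLIntegral_congr_fun (hm i) (fun x hx => by rw [averageOn_of_mem hd hx]),
    setLIntegral_const, ENNReal.mul_le_mul_iff_left (hpos i) (hfin i),
    Real.enorm_eq_ofReal_abs, ENNReal.ofReal_le_ofReal_iff hM] at h
  rwa [averageOn_of_mem hd hi]

variable [Countable ι]

theorem aestronglyMeasurable_averageOn (hf : AEStronglyMeasurable f μ) :
    AEStronglyMeasurable (averageOn μ Q f) μ := by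
  suffices AEStronglyMeasurable (averageOn μ Q f)
      (μ.restrict ((⋃ i, Q i) ∪ (⋃ i, Q i)ᶜ)) by
    rwa [Set.union_compl_self, Measure.restrict_univ] at this
  rw [aestronglyMeasurable_union_iff, aestronglyMeasurable_iUnion_iff]
  refine ⟨fun i => ?_, ?_⟩
  · refine (aestronglyMeasurable_const (b := ⨍ y in Q i, f y ∂μ)).congr ?_
    filter_upwards [ae_restrict_mem (hm i)] with x hx
    rw [averageOn_of_mem hd hx]
  · refine hf.restrict.congr ?_
    filter_upwards [ae_restrict_mem (MeasurableSet.iUnion hm).compl] with x hx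
    rw [averageOn_of_notMem hx]

theorem lintegral_enorm_averageOn_le (hfin : ∀ i, μ (Q i) ≠ ⊤) :
    ∫⁻ x, ‖averageOn μ Q f x‖ₑ ∂μ ≤ ∫⁻ x, ‖f x‖ₑ ∂μ := by
  have hU := MeasurableSet.iUnion hm
  rw [← lintegral_add_compl _ hU, ← lintegral_add_compl (fun x => ‖f x‖ₑ) hU,
    lintegral_iUnion hm hd, lintegral_iUnion hm hd]
  refine add_le_add (ENNReal.tsum_le_tsum fun i =>
    setLIntegral_enorm_averageOn_le hd hm hfin i) (le_of_eq ?_)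
  exact setLIntegral_congr_fun hU.compl fun x hx => by rw [averageOn_of_notMem hx]

theorem integrable_averageOn (hf : Integrable f μ) (hfin : ∀ i, μ (Q i) ≠ ⊤) :
    Integrable (averageOn μ Q f) μ :=
  ⟨aestronglyMeasurable_averageOn hd hm hf.1,
    (lintegral_enorm_averageOn_le hd hm hfin).trans_lt hf.2⟩

end Averaging

/-! ### Calderón–Zygmund kernels: the bad part and the `L²` distribution inequality. -/

section CalderonZygmund

open FourierTransform

variable {V : Type*} [NormedAddCommGroup V] [InnerProductSpace ℝ V] [FiniteDimensional ℝ V]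
  [MeasurableSpace V] [BorelSpace V]

/-- A bounded integrable kernel whose Fourier transform is bounded by `A` and which satisfies
Hörmander's condition with constant `A`. -/
structure IsCZKernel (A : ℝ≥0) (K : V → ℝ) : Prop where
  measurable : Measurable K
  integrable : Integrable K
  bounded : ∃ M, ∀ x, |K x| ≤ M
  fourier_le : ∀ ξ, ‖𝓕 (fun x => (K x : ℂ)) ξ‖ ≤ A
  hormander : ∀ y, ∫⁻ x in {x | 2 * ‖y‖ ≤ ‖x‖}, ‖K (x - y) - K x‖ₑ ≤ A

variable {A : ℝ≥0} {K : V → ℝ}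

/-- Translation by `c`: off the ball, `‖x - c‖ ≥ 2 * r ≥ 2 * ‖y - c‖`. -/
theorem IsCZKernel.hormander_centered (hK : IsCZKernel A K) {c y : V} {r : ℝ}
    (hy : ‖y - c‖ ≤ r) :
    ∫⁻ x in (Metric.ball c (2 * r))ᶜ, ‖K (x - y) - K (x - c)‖ₑ ≤ A := by
  refine le_trans ?_ (hK.hormander (y - c))
  have hms : MeasurableSet {x : V | 2 * ‖y - c‖ ≤ ‖x‖} :=
    measurableSet_le measurable_const measurable_norm
  rw [← lintegral_indicator Metric.isOpen_ball.measurableSet.compl, ← lintegral_indicator hms,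
    ← lintegral_sub_right_eq_self ({x : V | 2 * ‖y - c‖ ≤ ‖x‖}.indicator _) c]
  refine lintegral_mono fun x => ?_
  by_cases hx : x ∈ (Metric.ball c (2 * r))ᶜ
  · have hx' : 2 * ‖y - c‖ ≤ ‖x - c‖ := by
      rw [Set.mem_compl_iff, Metric.mem_ball, not_lt, dist_eq_norm] at hx
      linarith
    rw [Set.indicator_of_mem hx, Set.indicator_of_mem (by exact hx')]
    rw [sub_sub_sub_cancel_right]
  · rw [Set.indicator_of_notMem hx]
    exact zero_le

/-- The estimate for the bad part in the Calderón–Zygmund decomposition. -/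
theorem IsCZKernel.lintegral_enorm_realConv_le (hK : IsCZKernel A K) {ι : Type*} [Countable ι]
    {Q : ι → Set V} (hd : Pairwise (Function.onFun Disjoint Q)) (hm : ∀ i, MeasurableSet (Q i))
    {c : ι → V} {r : ι → ℝ} (hQ : ∀ i, ∀ y ∈ Q i, ‖y - c i‖ ≤ r i) {b : V → ℝ}
    (hb : Integrable b) (hb0 : ∀ x, x ∉ ⋃ i, Q i → b x = 0) (hbQ : ∀ i, ∫ x in Q i, b x = 0) :
    ∫⁻ x in (⋃ i, Metric.ball (c i) (2 * r i))ᶜ, ‖realConv K b x‖ₑ ≤ A * ∫⁻ x, ‖b x‖ₑ := by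
  obtain ⟨M, hM⟩ := hK.bounded
  have hKm := hK.measurable
  have hint : ∀ x, Integrable (fun y => K (x - y) * b y) := fun x =>
    hb.bdd_mul (hKm.comp (measurable_const.sub measurable_id)).aestronglyMeasurable
      (Filter.Eventually.of_forall fun y => hM (x - y))
  have hpt : ∀ x, ‖realConv K b x‖ₑ ≤
      ∑' i, ∫⁻ y in Q i, ‖K (x - y) - K (x - c i)‖ₑ * ‖b y‖ₑ := by
    intro x
    have h1 : realConv K b x = ∑' i, ∫ y in Q i, K (x - y) * b y := by
      rw [realConv_eq_swap, ← integral_iUnion hm hd (hint x).integrableOn]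
      refine (setIntegral_eq_integral_of_forall_compl_eq_zero fun y hy => ?_).symm
      rw [hb0 y hy, mul_zero]
    rw [h1]
    refine enorm_tsum_le_tsum_enorm.trans (ENNReal.tsum_le_tsum fun i => ?_)
    -- Mean value zero of `b` on `Q i` allows `K (x - c i)` to be subtracted, which brings in
    -- Hörmander's condition.
    have h2 : ∫ y in Q i, K (x - y) * b y = ∫ y in Q i, (K (x - y) - K (x - c i)) * b y := by
      simp_rw [sub_mul]
      rw [integral_sub (hint x).integrableOn (hb.const_mul _).integrableOn,
        integral_const_mul, hbQ, mul_zero, sub_zero]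
    rw [h2]
    refine (enorm_integral_le_lintegral_enorm _).trans_eq ?_
    simp_rw [enorm_mul]
  have hmeas : ∀ i, AEMeasurable (Function.uncurry fun x y =>
      ‖K (x - y) - K (x - c i)‖ₑ * ‖b y‖ₑ)
      ((volume.restrict (⋃ i, Metric.ball (c i) (2 * r i))ᶜ).prod (volume.restrict (Q i))) := by
    intro i
    refine AEMeasurable.mul (f := fun p : V × V => ‖K (p.1 - p.2) - K (p.1 - c i)‖ₑ)
      (g := fun p : V × V => ‖b p.2‖ₑ) ?_ ?_
    · have : Measurable fun p : V × V => K (p.1 - p.2) - K (p.1 - c i) := by fun_prop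
      exact this.enorm.aemeasurable
    · exact (hb.1.restrict.aemeasurable.enorm).comp_quasiMeasurePreserving
        Measure.quasiMeasurePreserving_snd
  calc ∫⁻ x in (⋃ i, Metric.ball (c i) (2 * r i))ᶜ, ‖realConv K b x‖ₑ
      ≤ ∫⁻ x in (⋃ i, Metric.ball (c i) (2 * r i))ᶜ,
          ∑' i, ∫⁻ y in Q i, ‖K (x - y) - K (x - c i)‖ₑ * ‖b y‖ₑ := lintegral_mono hpt
    _ = ∑' i, ∫⁻ x in (⋃ i, Metric.ball (c i) (2 * r i))ᶜ,
          ∫⁻ y in Q i, ‖K (x - y) - K (x - c i)‖ₑ * ‖b y‖ₑ :=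
        lintegral_tsum fun i => (hmeas i).lintegral_prod_right'
    _ ≤ ∑' i, ∫⁻ y in Q i, A * ‖b y‖ₑ := by
        refine ENNReal.tsum_le_tsum fun i => ?_
        rw [lintegral_lintegral_swap (hmeas i)]
        refine setLIntegral_mono' (hm i) fun y hy => ?_
        rw [lintegral_mul_const' _ _ enorm_ne_top]
        gcongr
        refine (lintegral_mono_set ?_).trans (hK.hormander_centered (hQ i y hy))
        exact Set.compl_subset_compl.2 (Set.subset_iUnion (fun i => Metric.ball (c i) (2 * r i)) i)
    _ = ∫⁻ y in ⋃ i, Q i, A * ‖b y‖ₑ := (lintegral_iUnion hm hd _).symm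
    _ ≤ ∫⁻ y, A * ‖b y‖ₑ := setLIntegral_le_lintegral _ _
    _ = A * ∫⁻ x, ‖b x‖ₑ := lintegral_const_mul' _ _ ENNReal.coe_ne_top

theorem IsCZKernel.realConv_add (hK : IsCZKernel A K) {f g : V → ℝ} (hf : Integrable f)
    (hg : Integrable g) (x : V) :
    realConv K (fun x => f x + g x) x = realConv K f x + realConv K g x := by
  obtain ⟨M, hM⟩ := hK.bounded
  simp only [realConv, mul_add]
  exact integral_add (integrable_realConv_integrand hK.measurable hM hf x)
    (integrable_realConv_integrand hK.measurable hM hg x)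

theorem volume_lt_abs_le_div (g : V → ℝ) (hg : AEStronglyMeasurable g) {t : ℝ} (ht : 0 < t)
    {S : Set V} (hS : MeasurableSet S) :
    volume ({x | t < |g x|} ∩ S) ≤ (∫⁻ x in S, ‖g x‖ₑ) / ENNReal.ofReal t := by
  rw [← Measure.restrict_apply' hS]
  refine le_trans (measure_mono fun x hx => ?_) (meas_ge_le_lintegral_div
    hg.restrict.aemeasurable.enorm (ENNReal.ofReal_pos.2 ht).ne' ENNReal.ofReal_ne_top)
  rw [Set.mem_ofPred_eq, Real.enorm_eq_ofReal_abs]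
  exact ENNReal.ofReal_le_ofReal (le_of_lt hx)

/-- The `L²` estimate in the form of a distribution inequality. -/
theorem IsCZKernel.volume_lt_abs_realConv_le (hK : IsCZKernel A K) {g : V → ℝ}
    (hg : Integrable g) (hg2 : MemLp g 2) {t : ℝ} (ht : 0 < t) :
    volume {x | t < |realConv K g x|} ≤
      A ^ 2 * (∫⁻ x, ‖g x‖ₑ ^ (2 : ℝ)) / ENNReal.ofReal t ^ 2 := by
  obtain ⟨M, hM⟩ := hK.bounded
  have h := eLpNorm_two_realConv_le hK.integrable hM hK.fourier_le hg hg2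
  have hT := integrable_realConv hK.integrable hg
  have e : ∀ u : V → ℝ, ∫⁻ x, ‖u x‖ₑ ^ (2 : ℝ) = eLpNorm u 2 volume ^ 2 := by
    intro u
    rw [eLpNorm_eq_lintegral_rpow_enorm_toReal (by norm_num) (by norm_num), ← ENNReal.rpow_natCast,
      ← ENNReal.rpow_mul]
    simp
  have h0 : ENNReal.ofReal t ^ 2 ≠ 0 := (ENNReal.pow_pos (ENNReal.ofReal_pos.2 ht) 2).ne'
  have h1 : ENNReal.ofReal t ^ 2 ≠ ⊤ := ENNReal.pow_ne_top ENNReal.ofReal_ne_top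
  calc volume {x | t < |realConv K g x|}
      ≤ volume {x | ENNReal.ofReal t ^ 2 ≤ ‖realConv K g x‖ₑ ^ (2 : ℝ)} := by
        refine measure_mono fun x hx => ?_
        rw [Set.mem_ofPred_eq, Real.enorm_eq_ofReal_abs, ENNReal.rpow_ofNat]
        have := ENNReal.ofReal_le_ofReal (le_of_lt hx)
        gcongr
    _ ≤ (∫⁻ x, ‖realConv K g x‖ₑ ^ (2 : ℝ)) / ENNReal.ofReal t ^ 2 :=
        meas_ge_le_lintegral_div (hT.1.aemeasurable.enorm.pow_const _) h0 h1
    _ ≤ _ := by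
        rw [e, e, ← mul_pow]
        gcongr

end CalderonZygmund

/-! ### The weak type `(1, 1)` estimate. -/

section WeakType

variable {n : ℕ} [NeZero n] {A : ℝ≥0}

/-- The constant in the weak type `(1, 1)` estimate. -/
noncomputable def weakConst (n : ℕ) (A : ℝ≥0) : ℝ≥0∞ :=
  2 ^ n * A ^ 2 +
    ENNReal.ofReal ((2 * √n) ^ n) * volume (Metric.ball (0 : EuclideanSpace ℝ (Fin n)) 1) + 2 * A

omit [NeZero n] in
theorem weakConst_ne_top : weakConst n A ≠ ⊤ := by
  have : volume (Metric.ball (0 : EuclideanSpace ℝ (Fin n)) 1) ≠ ⊤ := measure_ball_lt_top.ne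
  unfold weakConst
  finiteness

/-- The weak type `(1, 1)` estimate. -/
theorem IsCZKernel.weak_type {K : EuclideanSpace ℝ (Fin n) → ℝ} (hK : IsCZKernel A K)
    {f : EuclideanSpace ℝ (Fin n) → ℝ} (hf : Integrable f) {t : ℝ} (ht : 0 < t) :
    volume {x | 2 * t < |realConv K f x|} ≤
      weakConst n A * (∫⁻ x, ‖f x‖ₑ) / ENNReal.ofReal t := by
  set T := ENNReal.ofReal t with hT
  have hT0 : T ≠ 0 := (ENNReal.ofReal_pos.2 ht).ne'
  have hTt : T ≠ ⊤ := ENNReal.ofReal_ne_top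
  set I := maximalDyadicCubes (fun y => ‖f y‖ₑ) T with hI
  set Q : I → Set (EuclideanSpace ℝ (Fin n)) := fun p => dyadicCube p.1.1 p.1.2 with hQdef
  have hd : Pairwise (Function.onFun Disjoint Q) := fun p q hpq =>
    maximalDyadicCubes_disjoint p.2 q.2 fun h => hpq (Subtype.ext h)
  have hm : ∀ p, MeasurableSet (Q p) := fun p => measurableSet_dyadicCube _ _
  have hfin : ∀ p, volume (Q p) ≠ ⊤ := fun p => volume_dyadicCube_ne_top _ _
  have hpos : ∀ p, volume (Q p) ≠ 0 := fun p => (volume_dyadicCube_pos _ _).ne'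
  set F := ∫⁻ x, ‖f x‖ₑ with hF
  -- the total volume of the cubes
  have hvol : ∑' p, volume (Q p) ≤ F / T := by
    rw [ENNReal.le_div_iff_mul_le (Or.inl hT0) (Or.inl hTt), mul_comm, ← ENNReal.tsum_mul_left]
    calc ∑' p, T * volume (Q p) ≤ ∑' p, ∫⁻ x in Q p, ‖f x‖ₑ :=
          ENNReal.tsum_le_tsum fun p => p.2.1.le
      _ = ∫⁻ x in ⋃ p, Q p, ‖f x‖ₑ := (lintegral_iUnion hm hd _).symm
      _ ≤ F := setLIntegral_le_lintegral _ _
  -- the good function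
  set g := averageOn volume Q f with hg
  have hgi : Integrable g := integrable_averageOn hd hm hf hfin
  have hgle : ∫⁻ x, ‖g x‖ₑ ≤ F := lintegral_enorm_averageOn_le hd hm hfin
  have hgb : ∀ᵐ x, |g x| ≤ 2 ^ n * t := by
    filter_upwards [ae_abs_le_of_notMem_maximalDyadicCubes hf ht] with x hx
    by_cases hxU : x ∈ ⋃ p, Q p
    · refine abs_averageOn_le_of_mem hd hm hpos hfin (by positivity) (fun p => ?_) hxU
      refine (lintegral_maximalDyadicCube_le p.2).trans_eq ?_
      rw [ENNReal.ofReal_mul (by positivity), ENNReal.ofReal_pow (by norm_num)]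
      simp [hT, hQdef]
    · rw [hg, averageOn_of_notMem hxU]
      refine (hx fun p hp hxp => hxU (Set.mem_iUnion.2 ⟨⟨p, hp⟩, hxp⟩)).trans ?_
      have : (1 : ℝ) ≤ 2 ^ n := one_le_pow₀ one_le_two
      nlinarith
  have hg2 : MemLp g 2 := memLp_of_integrable_of_bounded hgi hgb (by norm_num) (by norm_num)
  -- Since `|g| ≤ 2 ^ n * t`, the integral of `g ^ 2` is at most `2 ^ n * t * F`, and one power of
  -- `t` cancels in the `L²` bound.
  have hgood : volume {x | t < |realConv K g x|} ≤ 2 ^ n * A ^ 2 * F / T := by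
    refine (hK.volume_lt_abs_realConv_le hgi hg2 ht).trans ?_
    have h2 := lintegral_enorm_rpow_le_of_bounded hgb (one_le_two)
    have h3 : ENNReal.ofReal (2 ^ n * t) ^ ((2 : ℝ) - 1) = 2 ^ n * T := by
      rw [show (2 : ℝ) - 1 = 1 by norm_num, ENNReal.rpow_one, ENNReal.ofReal_mul (by positivity),
        ENNReal.ofReal_pow (by norm_num)]
      simp [hT]
    rw [h3] at h2
    rw [ENNReal.div_le_iff (pow_ne_zero 2 hT0) (ENNReal.pow_ne_top hTt)]
    calc (A : ℝ≥0∞) ^ 2 * ∫⁻ x, ‖g x‖ₑ ^ (2 : ℝ) ≤ A ^ 2 * (2 ^ n * T * F) := by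
          gcongr
          exact h2.trans (by gcongr)
      _ = 2 ^ n * A ^ 2 * F * T := by ring
      _ = 2 ^ n * A ^ 2 * F / T * T ^ 2 := by
          rw [pow_two T, ← mul_assoc, ENNReal.div_mul_cancel hT0 hTt]
  -- the bad function
  set b : EuclideanSpace ℝ (Fin n) → ℝ := fun x => f x - g x with hb
  have hbi : Integrable b := hf.sub hgi
  have hble : ∫⁻ x, ‖b x‖ₑ ≤ 2 * F := by
    calc ∫⁻ x, ‖b x‖ₑ ≤ ∫⁻ x, (‖f x‖ₑ + ‖g x‖ₑ) := lintegral_mono fun x => enorm_sub_le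
      _ = F + ∫⁻ x, ‖g x‖ₑ := lintegral_add_left' hf.1.aemeasurable.enorm _
      _ ≤ 2 * F := by rw [two_mul]; gcongr
  have hne : ∀ p, (Q p).Nonempty := fun p => nonempty_of_measure_ne_zero (hpos p)
  choose c hc using hne
  -- The centre is any point of the cube and `√n * 2 ^ k` bounds its diameter. Doubling this radius
  -- meets the hypothesis of Hörmander's condition and keeps the volume proportional to that of the
  -- cube.
  set S := ⋃ p, Metric.ball (c p) (2 * (√n * 2 ^ (p : ℤ × (Fin n → ℤ)).1)) with hS
  have hSm : MeasurableSet S := MeasurableSet.iUnion fun p => Metric.isOpen_ball.measurableSet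
  have hbad : ∫⁻ x in Sᶜ, ‖realConv K b x‖ₑ ≤ A * (2 * F) := by
    refine (hK.lintegral_enorm_realConv_le hd hm (c := c)
      (r := fun p => √n * 2 ^ (p : ℤ × (Fin n → ℤ)).1) (fun p y hy =>
      norm_sub_le_of_mem_dyadicCube hy (hc p)) hbi (fun x hx => ?_) fun p => ?_).trans
      (by gcongr)
    · simp only [hb, hg]
      rw [averageOn_of_notMem hx, sub_self]
    · rw [hb, integral_sub hf.integrableOn hgi.integrableOn, setIntegral_averageOn hd hm hfin,
        sub_self]
  have hn : (0 : ℝ) < √n := Real.sqrt_pos.2 (by exact_mod_cast Nat.pos_of_ne_zero (NeZero.ne n))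
  have hSvol : volume S ≤ ENNReal.ofReal ((2 * √n) ^ n) *
      volume (Metric.ball (0 : EuclideanSpace ℝ (Fin n)) 1) * F / T := by
    rw [mul_div_assoc]
    refine (measure_iUnion_le _).trans ?_
    refine le_trans (le_of_eq ?_) (mul_le_mul_right hvol _)
    rw [← ENNReal.tsum_mul_left]
    refine tsum_congr fun p => ?_
    rw [Measure.addHaar_ball_of_pos _ _ (by positivity), finrank_euclideanSpace_fin,
      ← mul_assoc, mul_pow, ENNReal.ofReal_mul (by positivity), volume_dyadicCube,
      ENNReal.ofReal_pow (p := 2 ^ _) (by positivity)]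
    ring
  have hTf : ∀ x, realConv K f x = realConv K g x + realConv K b x := fun x => by
    rw [← hK.realConv_add hgi hbi]
    simp [hb]
  have hbm := (integrable_realConv hK.integrable hbi).1
  calc volume {x | 2 * t < |realConv K f x|}
      ≤ volume ({x | t < |realConv K g x|} ∪ S ∪ ({x | t < |realConv K b x|} ∩ Sᶜ)) := by
        refine measure_mono fun x hx => ?_
        by_cases h1 : x ∈ S
        · exact Or.inl (Or.inr h1)
        by_cases h2 : t < |realConv K g x|
        · exact Or.inl (Or.inl h2)
        refine Or.inr ⟨?_, h1⟩
        have hx' : 2 * t < |realConv K f x| := hx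
        rw [hTf] at hx'
        have := abs_add_le (realConv K g x) (realConv K b x)
        rw [Set.mem_ofPred_eq]
        linarith
    -- The three terms are the good part, the exceptional set `S`, and the bad part off `S`, the
    -- last with `‖b‖₁ ≤ 2 * F`.
    _ ≤ 2 ^ n * A ^ 2 * F / T + ENNReal.ofReal ((2 * √n) ^ n) *
          volume (Metric.ball (0 : EuclideanSpace ℝ (Fin n)) 1) * F / T + A * (2 * F) / T := by
        refine (measure_union_le _ _).trans (add_le_add ((measure_union_le _ _).trans
          (add_le_add hgood hSvol)) ?_)
        refine (volume_lt_abs_le_div _ hbm ht hSm.compl).trans ?_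
        gcongr
    _ = weakConst n A * F / T := by
        rw [← ENNReal.add_div, ← ENNReal.add_div, weakConst]
        congr 1
        ring

end WeakType

/-! ### Marcinkiewicz interpolation. -/

section Marcinkiewicz

theorem setLIntegral_Ioo_rpow {a s : ℝ} (ha : 0 ≤ a) (hs : -1 < s) :
    ∫⁻ t in Set.Ioo 0 a, ENNReal.ofReal (t ^ s) = ENNReal.ofReal (a ^ (s + 1) / (s + 1)) := by
  have h1 : IntegrableOn (fun t : ℝ => t ^ s) (Set.Ioc 0 a) :=
    (intervalIntegrable_iff_integrableOn_Ioc_of_le ha).1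
      (intervalIntegral.intervalIntegrable_rpow' hs)
  rw [Measure.restrict_congr_set Ioo_ae_eq_Ioc, ← ofReal_integral_eq_lintegral_ofReal h1,
    ← intervalIntegral.integral_of_le ha, integral_rpow (Or.inl hs),
    Real.zero_rpow (by linarith), sub_zero]
  filter_upwards [ae_restrict_mem measurableSet_Ioc] with t ht
  exact Real.rpow_nonneg ht.1.le _

theorem setLIntegral_Ici_rpow {a s : ℝ} (ha : 0 < a) (hs : s < -1) :
    ∫⁻ t in Set.Ici a, ENNReal.ofReal (t ^ s) = ENNReal.ofReal (a ^ (s + 1) / (-(s + 1))) := by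
  rw [Measure.restrict_congr_set Ioi_ae_eq_Ici.symm,
    ← ofReal_integral_eq_lintegral_ofReal (integrableOn_Ioi_rpow_of_lt hs ha),
    integral_Ioi_rpow_of_lt hs ha, div_neg, neg_div]
  filter_upwards [ae_restrict_mem measurableSet_Ioi] with t ht
  exact Real.rpow_nonneg (ha.le.trans (le_of_lt ht)) _

variable {α : Type*} [MeasurableSpace α] {μ : Measure α} [SFinite μ]

/-- By Tonelli the `t`-integral comes first: `∫ t ^ (p - 2)` over `(0, u)` is `u ^ (p - 1) / (p -
1)`, convergent at `0` because `p > 1`. -/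
theorem lintegral_upper_truncation {u : α → ℝ} (hu : Measurable u) (hu0 : ∀ x, 0 ≤ u x) {p : ℝ}
    (hp : 1 < p) :
    ∫⁻ t in Set.Ioi (0 : ℝ), (∫⁻ x in {x | t < u x}, ENNReal.ofReal (u x) ∂μ) /
      ENNReal.ofReal t * ENNReal.ofReal (t ^ (p - 1)) =
    ENNReal.ofReal (p - 1)⁻¹ * ∫⁻ x, ENNReal.ofReal (u x ^ p) ∂μ := by
  have h1 : ∀ t ∈ Set.Ioi (0 : ℝ), (∫⁻ x in {x | t < u x}, ENNReal.ofReal (u x) ∂μ) /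
      ENNReal.ofReal t * ENNReal.ofReal (t ^ (p - 1)) =
      ∫⁻ x, {q : ℝ × α | q.1 < u q.2}.indicator
        (fun q => ENNReal.ofReal (q.1 ^ (p - 2)) * ENNReal.ofReal (u q.2)) (t, x) ∂μ := by
    intro t ht
    have ht' : (0 : ℝ) < t := ht
    rw [div_eq_mul_inv, mul_assoc, ← ENNReal.ofReal_inv_of_pos ht', ← ENNReal.ofReal_mul
      (by positivity), mul_comm, ← lintegral_indicator (measurableSet_lt measurable_const hu),
      ← lintegral_const_mul' _ _ ENNReal.ofReal_ne_top]
    refine lintegral_congr fun x => ?_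
    by_cases hx : t < u x
    · rw [Set.indicator_of_mem (by exact hx), Set.indicator_of_mem (by exact hx)]
      congr 2
      rw [← Real.rpow_neg_one, ← Real.rpow_add ht']
      congr 1
      ring
    · rw [Set.indicator_of_notMem (by exact hx), Set.indicator_of_notMem (by exact hx), mul_zero]
  have hset : MeasurableSet {q : ℝ × α | q.1 < u q.2} :=
    measurableSet_lt measurable_fst (hu.comp measurable_snd)
  have hmeas : Measurable (Function.uncurry fun (t : ℝ) (x : α) =>
      {q : ℝ × α | q.1 < u q.2}.indicator
        (fun q => ENNReal.ofReal (q.1 ^ (p - 2)) * ENNReal.ofReal (u q.2)) (t, x)) := by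
    refine Measurable.indicator (f := fun q : ℝ × α => _) ?_ hset
    fun_prop
  rw [setLIntegral_congr_fun measurableSet_Ioi h1, lintegral_lintegral_swap hmeas.aemeasurable,
    ← lintegral_const_mul' _ _ ENNReal.ofReal_ne_top]
  refine lintegral_congr fun x => ?_
  have h2 : ∀ t ∈ Set.Ioi (0 : ℝ), {q : ℝ × α | q.1 < u q.2}.indicator
        (fun q => ENNReal.ofReal (q.1 ^ (p - 2)) * ENNReal.ofReal (u q.2)) (t, x) =
      (Set.Iio (u x)).indicator (fun t => ENNReal.ofReal (t ^ (p - 2))) t *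
        ENNReal.ofReal (u x) := by
    intro t _
    by_cases hx : t < u x
    · rw [Set.indicator_of_mem (by exact hx), Set.indicator_of_mem (by exact hx)]
    · rw [Set.indicator_of_notMem (by exact hx), Set.indicator_of_notMem (by exact hx), zero_mul]
  rw [setLIntegral_congr_fun measurableSet_Ioi h2, lintegral_mul_const' _ _ ENNReal.ofReal_ne_top,
    setLIntegral_indicator measurableSet_Iio, Set.Iio_inter_Ioi,
    setLIntegral_Ioo_rpow (hu0 x) (by linarith), ← ENNReal.ofReal_mul
      (div_nonneg (Real.rpow_nonneg (hu0 x) _) (by linarith)),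
    ← ENNReal.ofReal_mul (inv_nonneg.2 (by linarith))]
  congr 1
  rcases (hu0 x).eq_or_lt with h0 | h0
  · rw [← h0, mul_zero, Real.zero_rpow (by linarith), mul_zero]
  · rw [show u x ^ p = u x ^ (p - 2 + 1) * u x by
      rw [← Real.rpow_add_one h0.ne']; congr 1; ring]
    rw [show p - 2 + 1 = p - 1 by ring]
    ring

/-- The dual computation: `∫ t ^ (p - 3)` over `[u, ∞)` is `u ^ (p - 2) / (2 - p)`, convergent
because `p < 2`. Where `u = 0` the left side contributes nothing, and only an inequality is claimed.
-/
theorem lintegral_lower_truncation_le {u : α → ℝ} (hu : Measurable u) (hu0 : ∀ x, 0 ≤ u x) {p : ℝ}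
    (hp : p < 2) :
    ∫⁻ t in Set.Ioi (0 : ℝ), (∫⁻ x in {x | u x ≤ t}, ENNReal.ofReal (u x ^ 2) ∂μ) /
      ENNReal.ofReal t ^ 2 * ENNReal.ofReal (t ^ (p - 1)) ≤
    ENNReal.ofReal (2 - p)⁻¹ * ∫⁻ x, ENNReal.ofReal (u x ^ p) ∂μ := by
  have h1 : ∀ t ∈ Set.Ioi (0 : ℝ), (∫⁻ x in {x | u x ≤ t}, ENNReal.ofReal (u x ^ 2) ∂μ) /
      ENNReal.ofReal t ^ 2 * ENNReal.ofReal (t ^ (p - 1)) =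
      ∫⁻ x, {q : ℝ × α | u q.2 ≤ q.1}.indicator
        (fun q => ENNReal.ofReal (q.1 ^ (p - 3)) * ENNReal.ofReal (u q.2 ^ 2)) (t, x) ∂μ := by
    intro t ht
    have ht' : (0 : ℝ) < t := ht
    rw [div_eq_mul_inv, mul_assoc, ← ENNReal.ofReal_pow ht'.le,
      ← ENNReal.ofReal_inv_of_pos (by positivity), ← ENNReal.ofReal_mul
      (by positivity), mul_comm, ← lintegral_indicator (measurableSet_le hu measurable_const),
      ← lintegral_const_mul' _ _ ENNReal.ofReal_ne_top]
    refine lintegral_congr fun x => ?_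
    by_cases hx : u x ≤ t
    · rw [Set.indicator_of_mem (by exact hx), Set.indicator_of_mem (by exact hx)]
      congr 2
      rw [← Real.rpow_natCast, ← Real.rpow_neg ht'.le, ← Real.rpow_add ht']
      congr 1
      push_cast
      ring
    · rw [Set.indicator_of_notMem (by exact hx), Set.indicator_of_notMem (by exact hx), mul_zero]
  have hset : MeasurableSet {q : ℝ × α | u q.2 ≤ q.1} :=
    measurableSet_le (hu.comp measurable_snd) measurable_fst
  have hmeas : Measurable (Function.uncurry fun (t : ℝ) (x : α) =>
      {q : ℝ × α | u q.2 ≤ q.1}.indicator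
        (fun q => ENNReal.ofReal (q.1 ^ (p - 3)) * ENNReal.ofReal (u q.2 ^ 2)) (t, x)) := by
    refine Measurable.indicator (f := fun q : ℝ × α => _) ?_ hset
    fun_prop
  rw [setLIntegral_congr_fun measurableSet_Ioi h1, lintegral_lintegral_swap hmeas.aemeasurable,
    ← lintegral_const_mul' _ _ ENNReal.ofReal_ne_top]
  refine lintegral_mono fun x => ?_
  have h2 : ∀ t ∈ Set.Ioi (0 : ℝ), {q : ℝ × α | u q.2 ≤ q.1}.indicator
        (fun q => ENNReal.ofReal (q.1 ^ (p - 3)) * ENNReal.ofReal (u q.2 ^ 2)) (t, x) =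
      (Set.Ici (u x)).indicator (fun t => ENNReal.ofReal (t ^ (p - 3))) t *
        ENNReal.ofReal (u x ^ 2) := by
    intro t _
    by_cases hx : u x ≤ t
    · rw [Set.indicator_of_mem (by exact hx), Set.indicator_of_mem (by exact hx)]
    · rw [Set.indicator_of_notMem (by exact hx), Set.indicator_of_notMem (by exact hx), zero_mul]
  rw [setLIntegral_congr_fun measurableSet_Ioi h2, lintegral_mul_const' _ _ ENNReal.ofReal_ne_top,
    setLIntegral_indicator measurableSet_Ici]
  rcases (hu0 x).eq_or_lt with h0 | h0
  · rw [← h0]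
    simp
  · rw [Set.inter_eq_left.2 (Set.Ici_subset_Ioi.2 h0), setLIntegral_Ici_rpow h0 (by linarith),
      ← ENNReal.ofReal_mul (div_nonneg (Real.rpow_nonneg (hu0 x) _) (by linarith)),
      ← ENNReal.ofReal_mul (inv_nonneg.2 (by linarith))]
    refine le_of_eq ?_
    congr 1
    rw [show u x ^ p = u x ^ (p - 3 + 1) * u x ^ 2 by
      rw [← Real.rpow_natCast, ← Real.rpow_add h0]; congr 1; push_cast; ring]
    rw [show -(p - 3 + 1) = 2 - p by ring]
    ring

/-- Marcinkiewicz interpolation, on the level of the distribution inequalities satisfied by the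
truncations of `u`. -/
theorem lintegral_rpow_le_of_truncation {u v : α → ℝ} (hu : Measurable u) (hu0 : ∀ x, 0 ≤ u x)
    (hv : AEMeasurable v μ) (hv0 : ∀ x, 0 ≤ v x) {p : ℝ} (hp : 1 < p) (hp2 : p < 2)
    {W D : ℝ≥0∞} (hW : W ≠ ⊤) (hD : D ≠ ⊤)
    (h : ∀ t, 0 < t → μ {x | t < v x} ≤
      W * ((∫⁻ x in {x | t < u x}, ENNReal.ofReal (u x) ∂μ) / ENNReal.ofReal t) +
      D * ((∫⁻ x in {x | u x ≤ t}, ENNReal.ofReal (u x ^ 2) ∂μ) / ENNReal.ofReal t ^ 2)) :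
    ∫⁻ x, ENNReal.ofReal (v x ^ p) ∂μ ≤
      ENNReal.ofReal p * (W * ENNReal.ofReal (p - 1)⁻¹ + D * ENNReal.ofReal (2 - p)⁻¹) *
        ∫⁻ x, ENNReal.ofReal (u x ^ p) ∂μ := by
  have hm : Measurable fun t : ℝ => W * ((∫⁻ x in {x | t < u x}, ENNReal.ofReal (u x) ∂μ) /
      ENNReal.ofReal t * ENNReal.ofReal (t ^ (p - 1))) := by
    have h1 : Measurable fun t : ℝ => ∫⁻ x in {x | t < u x}, ENNReal.ofReal (u x) ∂μ := by
      refine Antitone.measurable fun s t hst => lintegral_mono_set fun x hx => ?_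
      exact lt_of_le_of_lt hst hx
    fun_prop
  -- Layer-cake formula for `v ^ p`.
  rw [lintegral_rpow_eq_lintegral_meas_lt_mul μ (Filter.Eventually.of_forall hv0) hv
    (by linarith), mul_assoc]
  gcongr
  calc ∫⁻ t in Set.Ioi (0 : ℝ), μ {x | t < v x} * ENNReal.ofReal (t ^ (p - 1))
      ≤ ∫⁻ t in Set.Ioi (0 : ℝ),
        (W * ((∫⁻ x in {x | t < u x}, ENNReal.ofReal (u x) ∂μ) / ENNReal.ofReal t *
          ENNReal.ofReal (t ^ (p - 1))) +
        D * ((∫⁻ x in {x | u x ≤ t}, ENNReal.ofReal (u x ^ 2) ∂μ) / ENNReal.ofReal t ^ 2 *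
          ENNReal.ofReal (t ^ (p - 1)))) := by
        refine setLIntegral_mono' measurableSet_Ioi fun t ht => ?_
        rw [← mul_assoc, ← mul_assoc, ← add_mul]
        gcongr
        exact h t ht
    _ ≤ _ := by
        rw [lintegral_add_left hm, lintegral_const_mul' _ _ hW, lintegral_const_mul' _ _ hD,
          lintegral_upper_truncation hu hu0 hp, add_mul, mul_assoc, mul_assoc]
        gcongr
        exact lintegral_lower_truncation_le hu hu0 hp2

end Marcinkiewicz

/-! ### Strong type for `1 < p < 2`. -/

section StrongType

variable {n : ℕ} [NeZero n] {A : ℝ≥0} {K : EuclideanSpace ℝ (Fin n) → ℝ}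

/-- Cut `f` at height `t`: the large part is handled by weak type at level `2 * t`, the bounded part
by `L²` at level `t`. The levels add up to `3 * t`, hence the division by `3`. -/
theorem IsCZKernel.volume_lt_abs_realConv_le_truncation (hK : IsCZKernel A K)
    {f : EuclideanSpace ℝ (Fin n) → ℝ} (hf : Integrable f) (hfm : Measurable f) {t : ℝ}
    (ht : 0 < t) : volume {x | t < |realConv K f x| / 3} ≤
      weakConst n A * ((∫⁻ x in {x | t < |f x|}, ENNReal.ofReal |f x|) / ENNReal.ofReal t) +
      A ^ 2 * ((∫⁻ x in {x | |f x| ≤ t}, ENNReal.ofReal (|f x| ^ 2)) / ENNReal.ofReal t ^ 2) := by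
  set s : Set (EuclideanSpace ℝ (Fin n)) := {x | t < |f x|} with hs
  have hsm : MeasurableSet s := measurableSet_lt measurable_const hfm.abs
  have hsc : {x | |f x| ≤ t} = sᶜ := by ext x; simp [hs]
  have h1 : Integrable (s.indicator f) := hf.indicator hsm
  have h2 : Integrable (sᶜ.indicator f) := hf.indicator hsm.compl
  have h2b : ∀ x, |sᶜ.indicator f x| ≤ t := by
    intro x
    by_cases hx : x ∈ sᶜ
    · rw [Set.indicator_of_mem hx]
      rw [← hsc] at hx
      exact hx
    · rw [Set.indicator_of_notMem hx, abs_zero]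
      exact ht.le
  have h22 : MemLp (sᶜ.indicator f) 2 :=
    memLp_of_integrable_of_bounded h2 (Filter.Eventually.of_forall h2b) (by norm_num) (by norm_num)
  have hTf : ∀ x, realConv K f x =
      realConv K (s.indicator f) x + realConv K (sᶜ.indicator f) x := fun x => by
    rw [← hK.realConv_add h1 h2]
    simp_rw [Set.indicator_self_add_compl_apply]
  rw [hsc]
  calc volume {x | t < |realConv K f x| / 3}
      ≤ volume ({x | 2 * t < |realConv K (s.indicator f) x|} ∪
          {x | t < |realConv K (sᶜ.indicator f) x|}) := by
        refine measure_mono fun x hx => ?_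
        by_contra hcon
        simp only [Set.mem_union, Set.mem_ofPred_eq, not_or, not_lt] at hcon
        have hx' : t < |realConv K f x| / 3 := hx
        rw [hTf] at hx'
        have := abs_add_le (realConv K (s.indicator f) x) (realConv K (sᶜ.indicator f) x)
        linarith [hcon.1, hcon.2]
    _ ≤ _ := measure_union_le _ _
    _ ≤ _ := by
        refine add_le_add ((hK.weak_type h1 ht).trans_eq ?_)
          ((hK.volume_lt_abs_realConv_le h2 h22 ht).trans_eq ?_)
        · rw [mul_div_assoc, ← lintegral_indicator hsm]
          congr 3
          ext x
          by_cases hx : x ∈ s <;> simp [hx, Real.enorm_eq_ofReal_abs]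
        · rw [mul_div_assoc, ← lintegral_indicator hsm.compl]
          congr 3
          ext x
          by_cases hx : x ∈ s
          · simp [hx]
          · simp only [Set.mem_compl_iff, hx, not_false_eq_true, Set.indicator_of_mem,
              Real.enorm_eq_ofReal_abs, ENNReal.rpow_ofNat]
            rw [ENNReal.ofReal_pow (abs_nonneg _)]

/-- Calderón–Zygmund kernels are bounded on `L^p` for `1 < p < 2`. -/
theorem exists_eLpNorm_realConv_le_of_lt_two (A : ℝ≥0) {p : ℝ} (hp : 1 < p) (hp2 : p < 2) :
    ∃ C : ℝ≥0, ∀ K : EuclideanSpace ℝ (Fin n) → ℝ, IsCZKernel A K →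
      ∀ f : EuclideanSpace ℝ (Fin n) → ℝ, Integrable f →
      eLpNorm (realConv K f) (ENNReal.ofReal p) volume ≤
        C * eLpNorm f (ENNReal.ofReal p) volume := by
  set C : ℝ≥0∞ := ENNReal.ofReal (3 ^ p) * (ENNReal.ofReal p *
    (weakConst n A * ENNReal.ofReal (p - 1)⁻¹ + A ^ 2 * ENNReal.ofReal (2 - p)⁻¹)) with hC
  have hCt : C ≠ ⊤ := by
    have := weakConst_ne_top (n := n) (A := A)
    rw [hC]
    finiteness
  have hCt' : C ^ (1 / p) ≠ ⊤ := ENNReal.rpow_ne_top_of_nonneg (by positivity) hCt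
  refine ⟨(C ^ (1 / p)).toNNReal, fun K hK f hf => ?_⟩
  -- The convolution depends only on the almost-everywhere class of `f`, while the truncation sets
  -- must be measurable.
  wlog hfm : Measurable f generalizing f
  · have hae := hf.1.ae_eq_mk
    have hconv : realConv K f = realConv K (hf.1.mk f) := by
      ext x
      rw [realConv_eq_swap, realConv_eq_swap]
      refine integral_congr_ae ?_
      filter_upwards [hae] with y hy
      rw [hy]
    rw [hconv, eLpNorm_congr_ae hae]
    exact this _ (hf.congr hae) hf.1.stronglyMeasurable_mk.measurable
  have hT := integrable_realConv hK.integrable hf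
  have hmain := lintegral_rpow_le_of_truncation (μ := volume) (u := fun x => |f x|)
    (v := fun x => |realConv K f x| / 3) hfm.abs (fun x => abs_nonneg _)
    (hT.1.aemeasurable.abs.div_const 3) (fun x => by positivity) hp hp2
    weakConst_ne_top (by finiteness)
    (fun t ht => hK.volume_lt_abs_realConv_le_truncation hf hfm ht)
  have e : ∀ u : EuclideanSpace ℝ (Fin n) → ℝ, eLpNorm u (ENNReal.ofReal p) volume =
      (∫⁻ x, ENNReal.ofReal (|u x| ^ p)) ^ (1 / p) := by
    intro u
    rw [eLpNorm_eq_lintegral_rpow_enorm_toReal (by simp; linarith) ENNReal.ofReal_ne_top,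
      ENNReal.toReal_ofReal (by linarith)]
    congr 1
    refine lintegral_congr fun x => ?_
    rw [Real.enorm_eq_ofReal_abs, ENNReal.ofReal_rpow_of_nonneg (abs_nonneg _) (by linarith)]
  have h3 : ∫⁻ x, ENNReal.ofReal (|realConv K f x| ^ p) =
      ENNReal.ofReal (3 ^ p) * ∫⁻ x, ENNReal.ofReal ((|realConv K f x| / 3) ^ p) := by
    rw [← lintegral_const_mul' _ _ ENNReal.ofReal_ne_top]
    refine lintegral_congr fun x => ?_
    rw [← ENNReal.ofReal_mul (by positivity), ← Real.mul_rpow (by norm_num) (by positivity)]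
    congr 2
    ring
  rw [ENNReal.coe_toNNReal hCt', e, e, ← ENNReal.mul_rpow_of_nonneg _ _ (by positivity), h3, hC,
    mul_assoc (ENNReal.ofReal (3 ^ p))]
  gcongr

end StrongType

/-! ### Duality and the full range of exponents. -/

section Duality

open FourierTransform

section

variable {V : Type*} [NormedAddCommGroup V] [InnerProductSpace ℝ V] [FiniteDimensional ℝ V]
  [MeasurableSpace V] [BorelSpace V] {A : ℝ≥0} {K : V → ℝ}

/-- All the conditions are invariant under reflection, so the transpose operator satisfies the same
bounds. -/
theorem IsCZKernel.comp_neg (hK : IsCZKernel A K) : IsCZKernel A (fun x => K (-x)) where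
  measurable := hK.measurable.comp measurable_neg
  integrable := hK.integrable.comp_neg
  bounded := hK.bounded.imp fun _ hM x => hM (-x)
  fourier_le ξ := by
    have : 𝓕 (fun x => (K (-x) : ℂ)) ξ = 𝓕 (fun x => (K x : ℂ)) (-ξ) := by
      rw [Real.fourier_eq, Real.fourier_eq, ← integral_neg_eq_self]
      simp
    rw [this]
    exact hK.fourier_le _
  hormander y := by
    refine le_trans (le_of_eq ?_) (hK.hormander (-y))
    have hms : ∀ y : V, MeasurableSet {x : V | 2 * ‖y‖ ≤ ‖x‖} := fun y =>
      measurableSet_le measurable_const measurable_norm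
    rw [← lintegral_indicator (hms _), ← lintegral_indicator (hms _), ← lintegral_neg_eq_self]
    refine lintegral_congr fun x => ?_
    by_cases hx : 2 * ‖y‖ ≤ ‖x‖
    · rw [Set.indicator_of_mem (by simpa using hx), Set.indicator_of_mem (by simpa using hx)]
      congr 3 <;> abel
    · rw [Set.indicator_of_notMem (by simpa using hx), Set.indicator_of_notMem (by simpa using hx)]

/-- The transpose of the convolution with `K` is the convolution with the reflected kernel. -/
theorem IsCZKernel.integral_realConv_mul (hK : IsCZKernel A K) {f g : V → ℝ} (hf : Integrable f)
    (hg : Integrable g) :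
    ∫ x, realConv K f x * g x = ∫ y, f y * realConv (fun x => K (-x)) g y := by
  obtain ⟨M, hM⟩ := hK.bounded
  simp_rw [realConv_eq_swap, ← integral_mul_const, ← integral_const_mul]
  have hint : Integrable (Function.uncurry fun x y => K (x - y) * f y * g x)
      (volume.prod volume) := by
    have h1 : Integrable (fun z : V × V => K (z.1 - z.2) * (g z.1 * f z.2))
        (volume.prod volume) :=
      (hg.mul_prod hf).bdd_mul (hK.measurable.comp
        (measurable_fst.sub measurable_snd)).aestronglyMeasurable
        (Filter.Eventually.of_forall fun z => hM (z.1 - z.2))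
    refine h1.congr (Filter.Eventually.of_forall fun z => ?_)
    simp only [Function.uncurry]
    ring
  rw [integral_integral_swap hint]
  refine integral_congr_ae (Filter.Eventually.of_forall fun y => ?_)
  refine integral_congr_ae (Filter.Eventually.of_forall fun x => ?_)
  simp only [neg_sub]
  ring

/-- Test `h = K * f` against `g = |h| ^ (q - 2) * h`. Then `∫ h * g = I := ∫ |h| ^ q` and `‖g‖_p = I
^ (1 / p)`, so transposition and Hölder give `I ≤ C * ‖f‖_q * I ^ (1 / p)`. As `h` is bounded and
integrable, `I` is finite and one may divide. The condition `q ≥ 2` keeps `|h| ^ (q - 2)` bounded,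
which makes `g` integrable. -/
theorem IsCZKernel.eLpNorm_realConv_le_of_conjugate (hK : IsCZKernel A K) {p q : ℝ}
    (hpq : p.HolderConjugate q) (hq : 2 ≤ q) {C : ℝ≥0}
    (hC : ∀ g : V → ℝ, Integrable g → eLpNorm (realConv (fun x => K (-x)) g) (ENNReal.ofReal p)
      volume ≤ C * eLpNorm g (ENNReal.ofReal p) volume)
    {f : V → ℝ} (hf : Integrable f) :
    eLpNorm (realConv K f) (ENNReal.ofReal q) volume ≤
      C * eLpNorm f (ENNReal.ofReal q) volume := by
  obtain ⟨M, hM⟩ := hK.bounded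
  have hq0 : 0 < q := by linarith
  have hp0 : 0 < p := hpq.pos
  set h := realConv K f with hh
  have hhi : Integrable h := integrable_realConv hK.integrable hf
  have hhb := abs_realConv_le hM hf
  have e : ∀ (r : ℝ) (u : V → ℝ), 0 < r → eLpNorm u (ENNReal.ofReal r) volume =
      (∫⁻ x, ‖u x‖ₑ ^ r) ^ (1 / r) := by
    intro r u hr
    rw [eLpNorm_eq_lintegral_rpow_enorm_toReal (by simpa) ENNReal.ofReal_ne_top,
      ENNReal.toReal_ofReal hr.le]
  set g : V → ℝ := fun x => |h x| ^ (q - 2) * h x with hg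
  have hgm : AEStronglyMeasurable g volume :=
    ((hhi.1.aemeasurable.abs.pow_const _).mul hhi.1.aemeasurable).aestronglyMeasurable
  have hgi : Integrable g := by
    refine hhi.bdd_mul (c := (M * ∫ y, |f y|) ^ (q - 2))
      (hhi.1.aemeasurable.abs.pow_const _).aestronglyMeasurable
      (Filter.Eventually.of_forall fun x => ?_)
    rw [Real.norm_eq_abs, abs_of_nonneg (by positivity)]
    exact Real.rpow_le_rpow (abs_nonneg _) (hhb x) (by linarith)
  set I := ∫⁻ x, ‖h x‖ₑ ^ q with hI
  have hIt : I ≠ ⊤ := by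
    refine ne_top_of_le_ne_top ?_ (lintegral_enorm_rpow_le_of_bounded
      (Filter.Eventually.of_forall hhb) (p := q) (by linarith))
    exact ENNReal.mul_ne_top (ENNReal.rpow_ne_top_of_nonneg (by linarith) ENNReal.ofReal_ne_top)
      hhi.2.ne
  have hgp : ∀ x, ‖g x‖ₑ ^ p = ‖h x‖ₑ ^ q := by
    intro x
    rw [hg, Real.enorm_eq_ofReal_abs, Real.enorm_eq_ofReal_abs,
      ENNReal.ofReal_rpow_of_nonneg (abs_nonneg _) hp0.le,
      ENNReal.ofReal_rpow_of_nonneg (abs_nonneg _) hq0.le]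
    congr 1
    rw [abs_mul, abs_of_nonneg (a := |h x| ^ (q - 2)) (by positivity)]
    rcases (abs_nonneg (h x)).eq_or_lt with h0 | h0
    · rw [← h0, mul_zero, Real.zero_rpow hp0.ne', Real.zero_rpow hq0.ne']
    · rw [← Real.rpow_add_one h0.ne', ← Real.rpow_mul h0.le]
      congr 1
      have := hpq.mul_eq_add
      linarith
  have hprod : ∀ x, ‖h x * g x‖ₑ = ‖h x‖ₑ ^ q := by
    intro x
    rw [hg, Real.enorm_eq_ofReal_abs, Real.enorm_eq_ofReal_abs,
      ENNReal.ofReal_rpow_of_nonneg (abs_nonneg _) hq0.le]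
    congr 1
    rw [abs_mul, abs_mul, abs_of_nonneg (a := |h x| ^ (q - 2)) (by positivity)]
    rcases (abs_nonneg (h x)).eq_or_lt with h0 | h0
    · rw [← h0, zero_mul, Real.zero_rpow hq0.ne']
    · rw [← Real.rpow_add_one h0.ne', mul_comm, ← Real.rpow_add_one h0.ne']
      congr 1
      ring
  have hI1 : I = ‖∫ x, h x * g x‖ₑ := by
    have hnn : ∀ x, 0 ≤ h x * g x := fun x => by
      have : h x * g x = |h x| ^ (q - 2) * (h x * h x) := by simp only [hg]; ring
      rw [this]
      exact mul_nonneg (by positivity) (mul_self_nonneg _)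
    rw [hI, Real.enorm_eq_ofReal (integral_nonneg hnn),
      integral_eq_lintegral_of_nonneg_ae (Filter.Eventually.of_forall hnn) (hhi.1.mul hgm)]
    have h1 : ∀ x, ENNReal.ofReal (h x * g x) = ‖h x‖ₑ ^ q := fun x => by
      rw [← hprod, Real.enorm_eq_ofReal (hnn x)]
    simp_rw [h1]
    exact (ENNReal.ofReal_toReal hIt).symm
  have hT := integrable_realConv hK.comp_neg.integrable hgi
  have hI2 : I ≤ C * eLpNorm f (ENNReal.ofReal q) volume * I ^ (1 / p) := by
    calc I = ‖∫ y, f y * realConv (fun x => K (-x)) g y‖ₑ := by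
          rw [hI1, hh, hK.integral_realConv_mul hf hgi]
      _ ≤ ∫⁻ y, ‖f y‖ₑ * ‖realConv (fun x => K (-x)) g y‖ₑ := by
          refine (enorm_integral_le_lintegral_enorm _).trans_eq ?_
          simp_rw [enorm_mul]
      _ ≤ eLpNorm f (ENNReal.ofReal q) volume *
            eLpNorm (realConv (fun x => K (-x)) g) (ENNReal.ofReal p) volume := by
          rw [e q _ hq0, e p _ hp0]
          exact ENNReal.lintegral_mul_le_Lp_mul_Lq _ hpq.symm hf.1.aemeasurable.enorm
            hT.1.aemeasurable.enorm
      _ ≤ eLpNorm f (ENNReal.ofReal q) volume *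
            (C * eLpNorm g (ENNReal.ofReal p) volume) := by
          gcongr
          exact hC g hgi
      _ = C * eLpNorm f (ENNReal.ofReal q) volume * I ^ (1 / p) := by
          rw [e p g hp0]
          simp_rw [hgp]
          ring
  rw [e q h hq0, ← hI]
  rcases eq_or_ne I 0 with h0 | h0
  · rw [h0, ENNReal.zero_rpow_of_pos (by positivity)]
    exact zero_le
  have hIp0 : I ^ (1 / p) ≠ 0 := (ENNReal.rpow_pos (pos_iff_ne_zero.2 h0) hIt).ne'
  have hIpt : I ^ (1 / p) ≠ ⊤ := ENNReal.rpow_ne_top_of_nonneg (by positivity) hIt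
  rw [← ENNReal.mul_le_mul_iff_left hIp0 hIpt]
  refine le_trans (le_of_eq ?_) hI2
  rw [← ENNReal.rpow_add _ _ h0 hIt]
  have := hpq.inv_add_inv_eq_one
  rw [one_div, one_div, add_comm, this, ENNReal.rpow_one]

end

/-- Calderón–Zygmund kernels are bounded on `L^q` for `1 < q < ∞`, with a bound that depends only
on the dimension, `q`, and the constant of the kernel. -/
theorem exists_eLpNorm_realConv_le {n : ℕ} [NeZero n] (A : ℝ≥0) {q : ℝ≥0∞} (hq : 1 < q)
    (hq' : q < ⊤) :
    ∃ C : ℝ≥0, ∀ K : EuclideanSpace ℝ (Fin n) → ℝ, IsCZKernel A K →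
      ∀ f : EuclideanSpace ℝ (Fin n) → ℝ, Integrable f → MemLp f q →
      eLpNorm (realConv K f) q volume ≤ C * eLpNorm f q volume := by
  obtain ⟨r, hr, rfl⟩ : ∃ r : ℝ, 1 < r ∧ q = ENNReal.ofReal r := by
    refine ⟨q.toReal, ?_, (ENNReal.ofReal_toReal hq'.ne).symm⟩
    rw [← ENNReal.toReal_one]
    exact (ENNReal.toReal_lt_toReal ENNReal.one_ne_top hq'.ne).2 hq
  rcases lt_trichotomy r 2 with h2 | rfl | h2
  · obtain ⟨C, hC⟩ := exists_eLpNorm_realConv_le_of_lt_two (n := n) A hr h2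
    exact ⟨C, fun K hK f hf _ => hC K hK f hf⟩
  · refine ⟨A, fun K hK f hf hf2 => ?_⟩
    obtain ⟨M, hM⟩ := hK.bounded
    rw [ENNReal.ofReal_ofNat] at hf2 ⊢
    exact eLpNorm_two_realConv_le hK.integrable hM hK.fourier_le hf hf2
  · have hconj : (Real.conjExponent r).HolderConjugate r :=
      (Real.HolderConjugate.conjExponent hr).symm
    obtain ⟨C, hC⟩ := exists_eLpNorm_realConv_le_of_lt_two (n := n) A hconj.lt (by
      rw [Real.conjExponent, div_lt_iff₀ (by linarith)]
      linarith)
    exact ⟨C, fun K hK f hf _ =>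
      hK.eLpNorm_realConv_le_of_conjugate hconj h2.le (fun g hg => hC _ hK.comp_neg g hg) hf⟩

end Duality

/-! ### Polar coordinates. -/

section Polar

variable {n : ℕ} [NeZero n]

theorem nontrivial_euclideanSpace_fin : Nontrivial (EuclideanSpace ℝ (Fin n)) :=
  Module.nontrivial_of_finrank_pos (R := ℝ) (by
    rw [finrank_euclideanSpace_fin]; exact Nat.pos_of_ne_zero (NeZero.ne n))

theorem lintegral_fun_norm {f : ℝ → ℝ≥0∞} (hf : Measurable f) :
    ∫⁻ x : EuclideanSpace ℝ (Fin n), f ‖x‖ =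
      n * volume (Metric.ball (0 : EuclideanSpace ℝ (Fin n)) 1) *
        ∫⁻ r in Set.Ioi (0 : ℝ), ENNReal.ofReal (r ^ (n - 1)) * f r := by
  have := nontrivial_euclideanSpace_fin (n := n)
  have hfr : Module.finrank ℝ (EuclideanSpace ℝ (Fin n)) = n := finrank_euclideanSpace_fin
  have hms : MeasurableSet ({0}ᶜ : Set (EuclideanSpace ℝ (Fin n))) :=
    (measurableSet_singleton _).compl
  have hmp :=
    (volume : Measure (EuclideanSpace ℝ (Fin n))).measurePreserving_homeomorphUnitSphereProd
  calc ∫⁻ x : EuclideanSpace ℝ (Fin n), f ‖x‖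
      = ∫⁻ x : ({0}ᶜ : Set (EuclideanSpace ℝ (Fin n))), f ‖x.1‖ ∂(volume.comap Subtype.val) := by
        rw [lintegral_subtype_comap hms fun x => f ‖x‖, restrict_compl_singleton]
    _ = ∫⁻ z, f z.2 ∂(volume.toSphere.prod (.volumeIoiPow
          (Module.finrank ℝ (EuclideanSpace ℝ (Fin n)) - 1))) := by
        rw [← hmp.lintegral_comp_emb (Homeomorph.measurableEmbedding _)]
        simp only [homeomorphUnitSphereProd_apply_snd_coe]
    _ = volume.toSphere Set.univ * ∫⁻ r : Set.Ioi (0 : ℝ), f r ∂(.volumeIoiPow (n - 1)) := by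
        rw [hfr, lintegral_prod _ (by fun_prop)]
        simp only [lintegral_const]
        rw [mul_comm]
    _ = _ := by
        rw [Measure.toSphere_apply_univ, hfr, Measure.volumeIoiPow,
          lintegral_withDensity_eq_lintegral_mul _ (by fun_prop) (by fun_prop)]
        congr 1
        exact lintegral_subtype_comap measurableSet_Ioi
          fun r => ENNReal.ofReal (r ^ (n - 1)) * f r

/-- In polar coordinates the integral is a product whose spherical factor vanishes. The product
formula for the Bochner integral needs no integrability, so `ψ` is arbitrary. -/
theorem integral_angular_mul_radial_eq_zero {Ω : EuclideanSpace ℝ (Fin n) → ℝ}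
    (hΩ : ∀ r : ℝ, 0 < r → ∀ x, x ≠ 0 → Ω (r • x) = Ω x)
    (h0 : ∫ x : Metric.sphere (0 : EuclideanSpace ℝ (Fin n)) 1, Ω x
      ∂((volume : Measure (EuclideanSpace ℝ (Fin n))).toSphere) = 0) (ψ : ℝ → ℝ) :
    ∫ x, Ω x * ψ ‖x‖ = 0 := by
  have := nontrivial_euclideanSpace_fin (n := n)
  have hms : MeasurableSet ({0}ᶜ : Set (EuclideanSpace ℝ (Fin n))) :=
    (measurableSet_singleton _).compl
  have hmp :=
    (volume : Measure (EuclideanSpace ℝ (Fin n))).measurePreserving_homeomorphUnitSphereProd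
  calc ∫ x, Ω x * ψ ‖x‖
      = ∫ x : ({0}ᶜ : Set (EuclideanSpace ℝ (Fin n))), Ω x.1 * ψ ‖x.1‖
          ∂(volume.comap Subtype.val) := by
        rw [integral_subtype_comap hms fun x => Ω x * ψ ‖x‖, restrict_compl_singleton]
    _ = ∫ z : Metric.sphere (0 : EuclideanSpace ℝ (Fin n)) 1 × Set.Ioi (0 : ℝ),
          Ω z.1 * ψ z.2 ∂(volume.toSphere.prod (.volumeIoiPow
          (Module.finrank ℝ (EuclideanSpace ℝ (Fin n)) - 1))) := by
        rw [← hmp.integral_comp (Homeomorph.measurableEmbedding _)]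
        refine integral_congr_ae (Filter.Eventually.of_forall fun x => ?_)
        have hx : x.1 ≠ 0 := x.2
        simp only [homeomorphUnitSphereProd_apply_fst_coe, homeomorphUnitSphereProd_apply_snd_coe]
        rw [hΩ _ (inv_pos.2 (norm_pos_iff.2 hx)) _ hx]
    _ = 0 := by
        rw [integral_prod_mul (fun z : Metric.sphere (0 : EuclideanSpace ℝ (Fin n)) 1 => Ω z)
          (fun r : Set.Ioi (0 : ℝ) => ψ r), h0, zero_mul]

end Polar

/-! ### The radial profile, uniformly in `β`. -/

section Profile

/-- The source of uniformity in `β`: `s ≤ 2 / β`, and `β * log (1 / β) ≤ 1 - β ≤ 1` bounds `(1 / β)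
^ β` by `e`. -/
theorem rpow_self_le_six {β s : ℝ} (hβ : 0 < β) (hβ1 : β ≤ 1) (hs : 0 < s) (h : β * s ≤ 2) :
    s ^ β ≤ 6 := by
  have h1 : s ≤ 2 * (1 / β) := by
    rw [mul_one_div, le_div_iff₀ hβ]; linarith
  calc s ^ β ≤ (2 * (1 / β)) ^ β := Real.rpow_le_rpow hs.le h1 hβ.le
    _ = 2 ^ β * (1 / β) ^ β := Real.mul_rpow (by norm_num) (by positivity)
    _ ≤ 2 * Real.exp 1 := by
        gcongr
        · calc (2 : ℝ) ^ β ≤ 2 ^ (1 : ℝ) := Real.rpow_le_rpow_of_exponent_le one_le_two hβ1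
            _ = 2 := Real.rpow_one 2
        · rw [Real.rpow_def_of_pos (by positivity)]
          apply Real.exp_le_exp.2
          have := Real.log_le_sub_one_of_pos (x := 1 / β) (by positivity)
          calc Real.log (1 / β) * β ≤ (1 / β - 1) * β := by gcongr
            _ = 1 - β := by field_simp
            _ ≤ 1 := by linarith
    _ ≤ 6 := by
        have := Real.exp_one_lt_d9
        linarith

variable {χ : ℝ → ℝ} {β : ℝ}

/-- From `χ 1 = 1` and slope at most `2` over an interval of length `1`. -/
theorem IsCutoff.abs_le_three (hχ : IsCutoff χ) {s : ℝ} (hs : 0 ≤ s) : |χ s| ≤ 3 := by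
  rcases le_total s 1 with h | h
  · rw [hχ.eq_one s (abs_le.2 ⟨by linarith, h⟩)]
    norm_num
  rcases le_total 2 s with h' | h'
  · rw [hχ.eq_zero s (h'.trans (le_abs_self s))]
    norm_num
  have hd : Differentiable ℝ χ := hχ.smooth.differentiable (by simp)
  have := Convex.norm_image_sub_le_of_norm_deriv_le (f := χ) (C := 2) (s := Set.univ)
    (x := 1) (y := s) (fun x _ => hd x) (fun x _ => hχ.deriv_le x) convex_univ trivial trivial
  rw [hχ.eq_one 1 (by simp), Real.norm_eq_abs, Real.norm_eq_abs,
    abs_of_nonneg (by linarith : 0 ≤ s - 1)] at this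
  have h1 := abs_le.1 this
  rw [abs_le]
  constructor <;> linarith [h1.1, h1.2]

theorem IsCutoff.deriv_eq_zero (hχ : IsCutoff χ) {s : ℝ} (hs : 2 < s) : deriv χ s = 0 := by
  have : χ =ᶠ[nhds s] fun _ => 0 := by
    filter_upwards [lt_mem_nhds hs] with t ht
    exact hχ.eq_zero t ((le_of_lt ht).trans (le_abs_self t))
  rw [this.deriv_eq, deriv_const]

theorem IsCutoff.rpow_mul_abs_le (hχ : IsCutoff χ) (hβ : 0 < β) (hβ1 : β ≤ 1) {s : ℝ}
    (hs : 0 < s) : s ^ β * |χ (β * s)| ≤ 18 := by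
  rcases le_total (β * s) 2 with h | h
  · have h1 := rpow_self_le_six hβ hβ1 hs h
    have h2 := hχ.abs_le_three (s := β * s) (by positivity)
    calc s ^ β * |χ (β * s)| ≤ 6 * 3 := by gcongr
      _ = 18 := by norm_num
  · rw [hχ.eq_zero _ (h.trans (le_abs_self _))]
    simp

/-- The chain-rule factor `β` is paired with one power of `s`; their product is at most `2` on the
support. -/
theorem IsCutoff.rpow_mul_abs_deriv_le (hχ : IsCutoff χ) (hβ : 0 < β) (hβ1 : β ≤ 1) {s : ℝ}
    (hs : 0 < s) : s ^ β * (β * s * |deriv χ (β * s)|) ≤ 24 := by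
  rcases le_or_gt (β * s) 2 with h | h
  · have h1 := rpow_self_le_six hβ hβ1 hs h
    have h2 := hχ.deriv_le (β * s)
    calc s ^ β * (β * s * |deriv χ (β * s)|) ≤ 6 * (2 * 2) := by gcongr
      _ = 24 := by norm_num
  · rw [hχ.deriv_eq_zero h]
    simp

/-- The radial profile of `nearKernel`. -/
noncomputable def radialProfile (n : ℕ) (χ : ℝ → ℝ) (β r : ℝ) : ℝ :=
  χ (β * r) / r ^ ((n : ℝ) - β)

variable {n : ℕ}

theorem nearKernel_eq (Ω : EuclideanSpace ℝ (Fin n) → ℝ) (y : EuclideanSpace ℝ (Fin n)) :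
    nearKernel Ω χ β y = Ω y * radialProfile n χ β ‖y‖ := by
  rw [nearKernel, radialProfile]
  ring

theorem radialProfile_eq {r : ℝ} (hr : 0 < r) :
    radialProfile n χ β r = χ (β * r) * r ^ (β - n) := by
  rw [radialProfile, div_eq_mul_inv, ← Real.rpow_neg hr.le, neg_sub]

theorem IsCutoff.abs_radialProfile_le (hχ : IsCutoff χ) (hβ : 0 < β) (hβ1 : β ≤ 1) {r : ℝ}
    (hr : 0 < r) : |radialProfile n χ β r| ≤ 18 / r ^ n := by
  rw [radialProfile_eq hr, abs_mul, Real.rpow_sub hr, Real.rpow_natCast,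
    abs_of_nonneg (a := r ^ β / r ^ n) (by positivity), mul_div_assoc', mul_comm]
  gcongr
  exact hχ.rpow_mul_abs_le hβ hβ1 hr

theorem IsCutoff.hasDerivAt_radialProfile (hχ : IsCutoff χ) {r : ℝ} (hr : 0 < r) :
    HasDerivAt (radialProfile n χ β) (deriv χ (β * r) * β * r ^ (β - n) +
      χ (β * r) * ((β - n) * r ^ (β - n - 1))) r := by
  have hd : Differentiable ℝ χ := hχ.smooth.differentiable (by simp)
  have h1 : HasDerivAt (fun r => χ (β * r)) (deriv χ (β * r) * β) r := by
    have h2 : HasDerivAt (fun r => β * r) β r := by simpa using (hasDerivAt_id r).const_mul β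
    exact (hd (β * r)).hasDerivAt.comp r h2
  have h3 := h1.mul (Real.hasDerivAt_rpow_const (p := β - n) (Or.inl hr.ne'))
  refine h3.congr_of_eventuallyEq ?_
  filter_upwards [lt_mem_nhds hr] with t ht
  exact radialProfile_eq ht

/-- Differentiating the power costs `|β - n| / r ≤ n / r`, giving `18 * n`; differentiating the
cutoff gives `24`. -/
theorem IsCutoff.abs_deriv_radialProfile_le [NeZero n] (hχ : IsCutoff χ) (hβ : 0 < β) (hβ1 : β ≤ 1)
    {r : ℝ} (hr : 0 < r) : |deriv (radialProfile n χ β) r| ≤ (18 * n + 24) / r ^ (n + 1) := by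
  have hn : (1 : ℝ) ≤ n := by exact_mod_cast Nat.one_le_iff_ne_zero.2 (NeZero.ne n)
  rw [(hχ.hasDerivAt_radialProfile hr).deriv]
  have e1 : r ^ (β - n) = r * (r ^ β / r ^ (n + 1)) := by
    rw [Real.rpow_sub hr, Real.rpow_natCast, pow_succ]
    field_simp
  have e2 : r ^ (β - n - 1) = r ^ β / r ^ (n + 1) := by
    rw [Real.rpow_sub hr, Real.rpow_sub hr, Real.rpow_natCast, Real.rpow_one, pow_succ, div_div]
  rw [e1, e2]
  have h1 := hχ.rpow_mul_abs_le hβ hβ1 hr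
  have h2 := hχ.rpow_mul_abs_deriv_le hβ hβ1 hr
  have hb : |β - n| ≤ n := abs_le.2 ⟨by linarith, by linarith⟩
  calc |deriv χ (β * r) * β * (r * (r ^ β / r ^ (n + 1))) +
        χ (β * r) * ((β - n) * (r ^ β / r ^ (n + 1)))|
      ≤ |deriv χ (β * r) * β * (r * (r ^ β / r ^ (n + 1)))| +
        |χ (β * r) * ((β - n) * (r ^ β / r ^ (n + 1)))| := abs_add_le _ _
    _ = (r ^ β * (β * r * |deriv χ (β * r)|) + |β - n| * (r ^ β * |χ (β * r)|)) / r ^ (n + 1) := by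
        simp only [abs_mul, abs_div, abs_pow, abs_of_pos hβ, abs_of_pos hr,
          abs_of_pos (Real.rpow_pos_of_pos hr β)]
        ring
    _ ≤ (24 + n * 18) / r ^ (n + 1) := by gcongr
    _ = (18 * n + 24) / r ^ (n + 1) := by ring

/-- Mean value inequality on `[r / 2, ∞)`; the derivative bound at `r / 2` produces `2 ^ (n + 1)`.
-/
theorem IsCutoff.abs_radialProfile_sub_le [NeZero n] (hχ : IsCutoff χ) (hβ : 0 < β) (hβ1 : β ≤ 1)
    {r s : ℝ} (hr : 0 < r) (hs : |s - r| ≤ r / 2) :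
    |radialProfile n χ β s - radialProfile n χ β r| ≤
      (18 * n + 24) * 2 ^ (n + 1) * |s - r| / r ^ (n + 1) := by
  have hmem : ∀ t ∈ Set.Ici (r / 2), 0 < t := fun t ht => (half_pos hr).trans_le ht
  have := Convex.norm_image_sub_le_of_norm_deriv_le (f := radialProfile n χ β)
    (C := (18 * n + 24) / (r / 2) ^ (n + 1)) (s := Set.Ici (r / 2)) (x := r) (y := s)
    (fun t ht => (hχ.hasDerivAt_radialProfile (hmem t ht)).differentiableAt)
    (fun t ht => (hχ.abs_deriv_radialProfile_le hβ hβ1 (hmem t ht)).trans (by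
      have : r / 2 ≤ t := ht
      gcongr)) (convex_Ici _) (by simp; linarith) (by
        have := (abs_le.1 hs).1
        simp only [Set.mem_Ici]; linarith)
  refine this.trans_eq ?_
  rw [Real.norm_eq_abs, div_pow]
  field_simp

end Profile

/-! ### The Dini modulus of continuity. -/

section Modulus

variable {n : ℕ} {Ω : EuclideanSpace ℝ (Fin n) → ℝ} {B₁ B₂ : ℝ}

theorem sphereModulus_mono (Ω : EuclideanSpace ℝ (Fin n) → ℝ) : Monotone (sphereModulus Ω) := by
  intro s t hst
  refine iSup_mono fun x => iSup_mono fun x' => iSup_mono fun hx => iSup_mono fun hx' => ?_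
  exact iSup_mono' fun h => ⟨h.trans hst, le_rfl⟩

theorem norm_unit_sub_unit_le {V : Type*} [NormedAddCommGroup V] [NormedSpace ℝ V] {x y : V}
    (hx : x ≠ 0) (hy : y ≠ 0) : ‖‖y‖⁻¹ • y - ‖x‖⁻¹ • x‖ ≤ 2 * ‖y - x‖ / ‖x‖ := by
  have hx' : 0 < ‖x‖ := norm_pos_iff.2 hx
  have hy' : 0 < ‖y‖ := norm_pos_iff.2 hy
  have h1 : ‖y‖⁻¹ • y - ‖x‖⁻¹ • x = (‖y‖⁻¹ - ‖x‖⁻¹) • y + ‖x‖⁻¹ • (y - x) := by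
    rw [sub_smul, smul_sub]; abel
  have h2 : |‖y‖⁻¹ - ‖x‖⁻¹| * ‖y‖ = |‖x‖ - ‖y‖| / ‖x‖ := by
    rw [inv_sub_inv hy'.ne' hx'.ne', abs_div, abs_of_pos (mul_pos hy' hx')]
    field_simp
  rw [h1]
  refine (norm_add_le _ _).trans ?_
  rw [norm_smul, norm_smul, Real.norm_eq_abs, h2, norm_inv, norm_norm, mul_div_assoc, two_mul]
  have h3 : |‖x‖ - ‖y‖| ≤ ‖y - x‖ := by
    rw [norm_sub_rev]; exact abs_norm_sub_norm_le x y
  refine add_le_add (by gcongr) (le_of_eq ?_)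
  rw [inv_mul_eq_div]

theorem IsDiniAngular.enorm_sub_le (hΩ : IsDiniAngular B₁ B₂ Ω) {x y : EuclideanSpace ℝ (Fin n)}
    (hx : x ≠ 0) (hy : y ≠ 0) {δ : ℝ} (h : 2 * ‖y - x‖ / ‖x‖ ≤ δ) :
    ‖Ω y - Ω x‖ₑ ≤ sphereModulus Ω δ := by
  have hx' : 0 < ‖x‖ := norm_pos_iff.2 hx
  have hy' : 0 < ‖y‖ := norm_pos_iff.2 hy
  rw [← hΩ.homogeneous _ (inv_pos.2 hx') x hx, ← hΩ.homogeneous _ (inv_pos.2 hy') y hy,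
    Real.enorm_eq_ofReal_abs]
  refine le_iSup_of_le (‖y‖⁻¹ • y) (le_iSup_of_le (‖x‖⁻¹ • x) (le_iSup_of_le ?_
    (le_iSup_of_le ?_ (le_iSup_of_le ((norm_unit_sub_unit_le hx hy).trans h) le_rfl))))
  · rw [norm_smul, norm_inv, norm_norm, inv_mul_cancel₀ hy'.ne']
  · rw [norm_smul, norm_inv, norm_norm, inv_mul_cancel₀ hx'.ne']

theorem setLIntegral_Ioo_inv_eq_top : ∫⁻ δ in Set.Ioo (0 : ℝ) 1, ENNReal.ofReal δ⁻¹ = ⊤ := by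
  by_contra hne
  have h1 : IntegrableOn (fun δ : ℝ => δ⁻¹) (Set.Ioo 0 1) := by
    refine ⟨by fun_prop, ?_⟩
    refine lt_of_le_of_lt (le_of_eq ?_) (lt_top_iff_ne_top.2 hne)
    refine setLIntegral_congr_fun measurableSet_Ioo fun δ hδ => ?_
    exact Real.enorm_eq_ofReal (inv_nonneg.2 hδ.1.le)
  have h2 : IntervalIntegrable (fun δ : ℝ => δ⁻¹) volume 0 1 := by
    rw [intervalIntegrable_iff_integrableOn_Ioo_of_le zero_le_one]
    exact h1
  simp [intervalIntegrable_inv_iff] at h2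

/-- A modulus bounded below by `η` would make the Dini integral dominate `η * ∫ dδ / δ = ∞`. -/
theorem IsDiniAngular.exists_sphereModulus_lt (hΩ : IsDiniAngular B₁ B₂ Ω) {η : ℝ≥0∞}
    (hη : 0 < η) : ∃ δ, 0 < δ ∧ sphereModulus Ω δ < η := by
  by_contra! hcon
  have h1 : ∫⁻ δ in Set.Ioo (0 : ℝ) 1, η * ENNReal.ofReal δ⁻¹ ≤ ENNReal.ofReal B₂ := by
    refine le_trans (setLIntegral_mono' measurableSet_Ioo fun δ hδ => ?_) hΩ.dini
    rw [ENNReal.ofReal_inv_of_pos hδ.1, ← div_eq_mul_inv]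
    gcongr
    exact hcon δ hδ.1
  rw [lintegral_const_mul _ (by fun_prop), setLIntegral_Ioo_inv_eq_top,
    ENNReal.mul_top hη.ne'] at h1
  exact absurd (lt_of_le_of_lt h1 ENNReal.ofReal_lt_top) (lt_irrefl _)

/-- Measurability of `Ω` is not part of the hypotheses; it comes from this continuity. -/
theorem IsDiniAngular.continuousOn (hΩ : IsDiniAngular B₁ B₂ Ω) : ContinuousOn Ω {0}ᶜ := by
  intro x hx
  have hx0 : x ≠ 0 := hx
  have hx' : 0 < ‖x‖ := norm_pos_iff.2 hx0
  refine ContinuousAt.continuousWithinAt ?_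
  rw [ContinuousAt, tendsto_iff_edist_tendsto_0, ENNReal.tendsto_nhds_zero]
  intro η hη
  obtain ⟨δ, hδ, hlt⟩ := hΩ.exists_sphereModulus_lt hη
  have h1 : Filter.Tendsto (fun y => 2 * ‖y - x‖ / ‖x‖) (nhds x) (nhds 0) := by
    have : Continuous fun y => 2 * ‖y - x‖ / ‖x‖ := by fun_prop
    simpa using this.tendsto x
  filter_upwards [h1.eventually (ge_mem_nhds hδ), isOpen_ne.mem_nhds hx0] with y hy hy0
  rw [edist_eq_enorm_sub]
  exact (hΩ.enorm_sub_le hx0 hy0 hy).trans hlt.le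

/-- The Dini integral in radial variables. -/
theorem IsDiniAngular.setLIntegral_sphereModulus_le (hΩ : IsDiniAngular B₁ B₂ Ω) {a : ℝ}
    (ha : 0 < a) :
    ∫⁻ r in Set.Ici a, sphereModulus Ω (a / r) * ENNReal.ofReal r⁻¹ ≤ ENNReal.ofReal B₂ := by
  have himg : (fun r : ℝ => a / r) '' Set.Ioi a = Set.Ioo 0 1 := by
    ext δ
    constructor
    · rintro ⟨r, hr, rfl⟩
      have hr' : a < r := hr
      exact ⟨div_pos ha (ha.trans hr'), (div_lt_one (ha.trans hr')).2 hr'⟩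
    · rintro ⟨h0, h1⟩
      refine ⟨a / δ, ?_, ?_⟩
      · rw [Set.mem_Ioi, lt_div_iff₀ h0]
        nlinarith
      · field_simp
  have hinj : Set.InjOn (fun r : ℝ => a / r) (Set.Ioi a) := by
    intro r hr s hs h
    have hr' : 0 < r := ha.trans hr
    have hs' : 0 < s := ha.trans hs
    simp only at h
    rw [div_eq_div_iff hr'.ne' hs'.ne'] at h
    exact (mul_left_cancel₀ ha.ne' h).symm
  have hder : ∀ r ∈ Set.Ioi a,
      HasDerivWithinAt (fun r : ℝ => a / r) (-a / r ^ 2) (Set.Ioi a) r := by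
    intro r hr
    have hr' : r ≠ 0 := (ha.trans hr).ne'
    have := (hasDerivAt_inv hr').const_mul a
    refine HasDerivAt.hasDerivWithinAt ?_
    simpa [div_eq_mul_inv] using this
  -- The substitution `δ = a / r` carries `dδ / δ` to `dr / r`.
  have key := lintegral_image_eq_lintegral_abs_deriv_mul measurableSet_Ioi hder hinj
    (fun δ => sphereModulus Ω δ / ENNReal.ofReal δ)
  rw [himg] at key
  rw [Measure.restrict_congr_set Ioi_ae_eq_Ici.symm]
  refine le_trans (le_of_eq ?_) hΩ.dini
  rw [key]
  refine setLIntegral_congr_fun measurableSet_Ioi fun r hr => ?_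
  have hr' : 0 < r := ha.trans hr
  rw [ENNReal.div_eq_inv_mul, ← ENNReal.ofReal_inv_of_pos (by positivity), ← mul_assoc, mul_comm,
    ← ENNReal.ofReal_mul (abs_nonneg _)]
  congr 2
  rw [neg_div, abs_neg, abs_of_pos (by positivity)]
  field_simp

end Modulus

/-! ### Hörmander's condition for the truncated kernel. -/

section TruncatedKernel

variable {n : ℕ} {Ω : EuclideanSpace ℝ (Fin n) → ℝ} {χ : ℝ → ℝ} {B₁ B₂ β ε : ℝ}

/-- The kernel `nearKernel` cut off at distance `ε` from the origin. -/
noncomputable def truncKernel (Ω : EuclideanSpace ℝ (Fin n) → ℝ) (χ : ℝ → ℝ) (β ε : ℝ) :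
    EuclideanSpace ℝ (Fin n) → ℝ :=
  {y | ε ≤ ‖y‖}.indicator (nearKernel Ω χ β)

/-- The radial profile of `truncKernel`. -/
noncomputable def truncProfile (n : ℕ) (χ : ℝ → ℝ) (β ε r : ℝ) : ℝ :=
  if ε ≤ r then radialProfile n χ β r else 0

theorem truncKernel_eq (y : EuclideanSpace ℝ (Fin n)) :
    truncKernel Ω χ β ε y = Ω y * truncProfile n χ β ε ‖y‖ := by
  by_cases h : ε ≤ ‖y‖
  · rw [truncKernel, Set.indicator_of_mem (by exact h), nearKernel_eq, truncProfile, if_pos h]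
  · rw [truncKernel, Set.indicator_of_notMem (by exact h), truncProfile, if_neg h, mul_zero]

theorem truncKernel_eq_zero {y : EuclideanSpace ℝ (Fin n)} (h : ‖y‖ < ε) :
    truncKernel Ω χ β ε y = 0 :=
  Set.indicator_of_notMem (by simpa using h) _

theorem IsCutoff.abs_truncProfile_le (hχ : IsCutoff χ) (hβ : 0 < β) (hβ1 : β ≤ 1) {r : ℝ}
    (hr : 0 < r) : |truncProfile n χ β ε r| ≤ 18 / r ^ n := by
  rw [truncProfile]
  split_ifs
  · exact hχ.abs_radialProfile_le hβ hβ1 hr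
  · rw [abs_zero]; positivity

theorem abs_truncKernel_le (hΩ : IsDiniAngular B₁ B₂ Ω) (hχ : IsCutoff χ) (hβ : 0 < β)
    (hβ1 : β ≤ 1) {y : EuclideanSpace ℝ (Fin n)} (hy : y ≠ 0) :
    |truncKernel Ω χ β ε y| ≤ 18 * B₁ / ‖y‖ ^ n := by
  have hB : 0 ≤ B₁ := (abs_nonneg _).trans (hΩ.bounded y hy)
  rw [truncKernel_eq, abs_mul]
  calc |Ω y| * |truncProfile n χ β ε ‖y‖| ≤ B₁ * (18 / ‖y‖ ^ n) := by
        gcongr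
        · exact hΩ.bounded y hy
        · exact hχ.abs_truncProfile_le hβ hβ1 (norm_pos_iff.2 hy)
    _ = 18 * B₁ / ‖y‖ ^ n := by ring

theorem abs_truncKernel_le_const (hB : 0 ≤ B₁) (hΩ : IsDiniAngular B₁ B₂ Ω) (hχ : IsCutoff χ)
    (hβ : 0 < β) (hβ1 : β ≤ 1) (hε : 0 < ε) (y : EuclideanSpace ℝ (Fin n)) :
    |truncKernel Ω χ β ε y| ≤ 18 * B₁ / ε ^ n := by
  rcases lt_or_ge ‖y‖ ε with h | h
  · rw [truncKernel_eq_zero h, abs_zero]; positivity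
  · refine (abs_truncKernel_le hΩ hχ hβ hβ1 (norm_pos_iff.1 (hε.trans_le h))).trans ?_
    gcongr

theorem measurable_truncKernel (hΩ : IsDiniAngular B₁ B₂ Ω) (hχ : IsCutoff χ) (hε : 0 < ε) :
    Measurable (truncKernel Ω χ β ε) := by
  classical
  rw [truncKernel, ← Set.piecewise_eq_indicator]
  have hsub : {y : EuclideanSpace ℝ (Fin n) | ε ≤ ‖y‖} ⊆ {0}ᶜ := fun y hy =>
    norm_pos_iff.1 (hε.trans_le hy)
  refine ContinuousOn.measurable_piecewise ?_ continuousOn_const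
    (measurableSet_le measurable_const measurable_norm)
  refine ContinuousOn.mono (s := {0}ᶜ) ?_ hsub
  have hχc : Continuous χ := hχ.smooth.continuous
  refine ContinuousOn.mul (hΩ.continuousOn.div (fun y hy => ?_) fun y hy => ?_) (by fun_prop)
  · exact (continuous_norm.continuousAt.rpow_const
      (Or.inl (norm_pos_iff.2 hy).ne')).continuousWithinAt
  · exact (Real.rpow_pos_of_pos (norm_pos_iff.2 hy) _).ne'

theorem integrable_truncKernel (hB : 0 ≤ B₁) (hΩ : IsDiniAngular B₁ B₂ Ω) (hχ : IsCutoff χ)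
    (hβ : 0 < β) (hβ1 : β ≤ 1) (hε : 0 < ε) : Integrable (truncKernel Ω χ β ε) := by
  have hsupp : Function.support (truncKernel Ω χ β ε) ⊆
      Metric.closedBall (0 : EuclideanSpace ℝ (Fin n)) (2 / β) := by
    intro y hy
    by_contra hcon
    rw [mem_closedBall_zero_iff, not_le, div_lt_iff₀ hβ] at hcon
    refine hy ?_
    rw [truncKernel_eq, truncProfile, radialProfile, hχ.eq_zero]
    · simp
    · rw [abs_of_nonneg (by positivity)]; linarith
  rw [← integrableOn_iff_integrable_of_support_subset hsupp]
  exact Measure.integrableOn_of_bounded measure_closedBall_lt_top.ne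
    (measurable_truncKernel hΩ hχ hε).aestronglyMeasurable
    (Filter.Eventually.of_forall (abs_truncKernel_le_const hB hΩ hχ hβ hβ1 hε))

variable [NeZero n]

/-- The Lipschitz constant in `IsCutoff.abs_radialProfile_sub_le`. -/
noncomputable def profileLip (n : ℕ) : ℝ := (18 * n + 24) * 2 ^ (n + 1)

/-- The jump at `ε` matters only if `ε` separates `r` and `s`. As `r / 2 ≤ s ≤ 3 * r / 2`, this
forces `2 * ε / 3 ≤ r ≤ 2 * ε`, and there the size bound suffices. -/
theorem abs_truncProfile_sub_le (hχ : IsCutoff χ) (hβ : 0 < β)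
    (hβ1 : β ≤ 1) {r s : ℝ} (hr : 0 < r) (hs : |s - r| ≤ r / 2) :
    |truncProfile n χ β ε s - truncProfile n χ β ε r| ≤
      profileLip n * |s - r| / r ^ (n + 1) +
        (Set.Icc (2 * ε / 3) (2 * ε)).indicator (fun r => 18 * 2 ^ n / r ^ n) r := by
  have hL : 0 ≤ profileLip n * |s - r| / r ^ (n + 1) := by
    unfold profileLip; positivity
  have hind : 0 ≤ (Set.Icc (2 * ε / 3) (2 * ε)).indicator (fun r => 18 * 2 ^ n / r ^ n) r :=
    Set.indicator_apply_nonneg fun _ => by positivity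
  obtain ⟨h1, h2⟩ := abs_le.1 hs
  have hs0 : 0 < s := by linarith
  unfold truncProfile
  split_ifs with hεs hεr hεr
  · have := hχ.abs_radialProfile_sub_le (n := n) hβ hβ1 hr hs
    unfold profileLip
    unfold profileLip at hL
    linarith
  · have hmem : r ∈ Set.Icc (2 * ε / 3) (2 * ε) := ⟨by linarith, by linarith⟩
    rw [Set.indicator_of_mem hmem, sub_zero]
    have h3 := hχ.abs_radialProfile_le (n := n) hβ hβ1 hs0
    have h4 : 18 / s ^ n ≤ 18 / (r / 2) ^ n := by
      gcongr
      linarith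
    have h5 : 18 / (r / 2) ^ n = 18 * 2 ^ n / r ^ n := by
      rw [div_pow]; field_simp
    linarith
  · have hmem : r ∈ Set.Icc (2 * ε / 3) (2 * ε) := ⟨by linarith, by linarith⟩
    rw [Set.indicator_of_mem hmem, zero_sub, abs_neg]
    have h3 := hχ.abs_radialProfile_le (n := n) hβ hβ1 hr
    have h4 : 18 / r ^ n ≤ 18 * 2 ^ n / r ^ n := by
      gcongr
      have : (1 : ℝ) ≤ 2 ^ n := one_le_pow₀ one_le_two
      linarith
    linarith
  · rw [sub_zero, abs_zero]; positivity

/-- The pointwise bound for the differences of `truncKernel`, as a function of the radius. -/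
noncomputable def kernelDiffBound (Ω : EuclideanSpace ℝ (Fin n) → ℝ) (B₁ ε ρ r : ℝ) : ℝ≥0∞ :=
  sphereModulus Ω (2 * ρ / r) * ENNReal.ofReal (18 / r ^ n) +
    (ENNReal.ofReal (B₁ * (profileLip n * ρ / r ^ (n + 1))) +
      (Set.Icc (2 * ε / 3) (2 * ε)).indicator
        (fun r => ENNReal.ofReal (B₁ * (18 * 2 ^ n / r ^ n))) r)

theorem enorm_truncKernel_sub_le (hΩ : IsDiniAngular B₁ B₂ Ω) (hχ : IsCutoff χ) (hβ : 0 < β)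
    (hβ1 : β ≤ 1) {x y : EuclideanSpace ℝ (Fin n)} (hy : y ≠ 0) (hxy : 2 * ‖y‖ ≤ ‖x‖) :
    ‖truncKernel Ω χ β ε (x - y) - truncKernel Ω χ β ε x‖ₑ ≤
      kernelDiffBound Ω B₁ ε ‖y‖ ‖x‖ := by
  have hy' : 0 < ‖y‖ := norm_pos_iff.2 hy
  have hx' : 0 < ‖x‖ := by linarith
  have hx : x ≠ 0 := norm_pos_iff.1 hx'
  have hdiff : |‖x - y‖ - ‖x‖| ≤ ‖y‖ := by
    have := abs_norm_sub_norm_le (x - y) x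
    simpa using this
  have hz' : 0 < ‖x - y‖ := by linarith [(abs_le.1 hdiff).1]
  have hz : x - y ≠ 0 := norm_pos_iff.1 hz'
  have hB : 0 ≤ B₁ := (abs_nonneg _).trans (hΩ.bounded x hx)
  -- Vary the angular factor first, then the radial one.
  have h1 : truncKernel Ω χ β ε (x - y) - truncKernel Ω χ β ε x =
      (Ω (x - y) - Ω x) * truncProfile n χ β ε ‖x‖ +
      Ω (x - y) * (truncProfile n χ β ε ‖x - y‖ - truncProfile n χ β ε ‖x‖) := by
    rw [truncKernel_eq, truncKernel_eq]; ring
  rw [h1, kernelDiffBound]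
  refine (enorm_add_le _ _).trans (add_le_add ?_ ?_)
  · rw [enorm_mul]
    gcongr
    · exact hΩ.enorm_sub_le hx hz (by simp)
    · rw [Real.enorm_eq_ofReal_abs]
      exact ENNReal.ofReal_le_ofReal (hχ.abs_truncProfile_le hβ hβ1 hx')
  · have h2 := abs_truncProfile_sub_le (n := n) (ε := ε) hχ hβ hβ1 hx'
      (s := ‖x - y‖) (by linarith)
    have h3 : |Ω (x - y) * (truncProfile n χ β ε ‖x - y‖ - truncProfile n χ β ε ‖x‖)| ≤
        B₁ * (profileLip n * ‖y‖ / ‖x‖ ^ (n + 1) +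
        (Set.Icc (2 * ε / 3) (2 * ε)).indicator (fun r => 18 * 2 ^ n / r ^ n) ‖x‖) := by
      rw [abs_mul]
      refine mul_le_mul (hΩ.bounded _ hz) (h2.trans ?_) (abs_nonneg _) hB
      have : 0 ≤ profileLip n := by unfold profileLip; positivity
      gcongr
    rw [Real.enorm_eq_ofReal_abs]
    refine (ENNReal.ofReal_le_ofReal h3).trans ?_
    rw [mul_add]
    refine ENNReal.ofReal_add_le.trans (add_le_add le_rfl (le_of_eq ?_))
    by_cases hm : ‖x‖ ∈ Set.Icc (2 * ε / 3) (2 * ε)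
    · rw [Set.indicator_of_mem hm, Set.indicator_of_mem hm]
    · rw [Set.indicator_of_notMem hm, Set.indicator_of_notMem hm, mul_zero, ENNReal.ofReal_zero]

omit [NeZero n] in
theorem measurable_kernelDiffBound (ρ : ℝ) : Measurable (kernelDiffBound Ω B₁ ε ρ) := by
  have h1 : Measurable fun r : ℝ => sphereModulus Ω (2 * ρ / r) :=
    (sphereModulus_mono Ω).measurable.comp
      (by fun_prop : Measurable fun r : ℝ => 2 * ρ / r)
  have h2 : Measurable ((Set.Icc (2 * ε / 3) (2 * ε)).indicator
      (fun r : ℝ => ENNReal.ofReal (B₁ * (18 * 2 ^ n / r ^ n)))) :=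
    Measurable.indicator (by fun_prop) measurableSet_Icc
  unfold kernelDiffBound
  fun_prop

/-- Against `r ^ (n - 1)` the three terms are scale invariant: `18 * ω(2ρ / r) / r` is a Dini
integral, `ρ / r ^ 2` integrates to `1 / 2` over `[2ρ, ∞)`, and `1 / r` over `[2ε / 3, 2ε]` is at
most length over left endpoint, `2`, which turns `18` into `36`. -/
theorem setLIntegral_kernelDiffBound_le (hΩ : IsDiniAngular B₁ B₂ Ω) (hB : 0 ≤ B₁) (hε : 0 < ε)
    {ρ : ℝ} (hρ : 0 < ρ) :
    ∫⁻ r in Set.Ici (2 * ρ), ENNReal.ofReal (r ^ (n - 1)) * kernelDiffBound Ω B₁ ε ρ r ≤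
      18 * ENNReal.ofReal B₂ + (ENNReal.ofReal (B₁ * profileLip n) +
        ENNReal.ofReal (B₁ * (36 * 2 ^ n))) := by
  have hL : 0 ≤ profileLip n := by unfold profileLip; positivity
  have hpow : ∀ r : ℝ, r ^ n = r * r ^ (n - 1) := fun r => by
    rw [← pow_succ', Nat.sub_add_cancel (Nat.pos_of_ne_zero (NeZero.ne n))]
  have h2ρ : 0 < 2 * ρ := by linarith
  have e1 : ∀ r ∈ Set.Ici (2 * ρ), ENNReal.ofReal (r ^ (n - 1)) * kernelDiffBound Ω B₁ ε ρ r =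
      18 * (sphereModulus Ω (2 * ρ / r) * ENNReal.ofReal r⁻¹) +
      (ENNReal.ofReal (B₁ * profileLip n * ρ) * ENNReal.ofReal (r ^ (-2 : ℝ)) +
      (Set.Icc (2 * ε / 3) (2 * ε)).indicator
        (fun r => ENNReal.ofReal (B₁ * (18 * 2 ^ n) / r)) r) := by
    intro r hr
    have hr' : 0 < r := h2ρ.trans_le hr
    rw [kernelDiffBound, mul_add, mul_add]
    congr 1
    · rw [mul_left_comm, mul_left_comm 18, ← ENNReal.ofReal_mul (by positivity),
        ← ENNReal.ofReal_ofNat 18, ← ENNReal.ofReal_mul (by norm_num), hpow]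
      congr 2
      field_simp
    congr 1
    · rw [← ENNReal.ofReal_mul (by positivity), ← ENNReal.ofReal_mul (by positivity)]
      congr 1
      rw [pow_succ, hpow, Real.rpow_neg hr'.le, Real.rpow_ofNat]
      field_simp
    · by_cases hm : r ∈ Set.Icc (2 * ε / 3) (2 * ε)
      · rw [Set.indicator_of_mem hm, Set.indicator_of_mem hm, ← ENNReal.ofReal_mul (by positivity)]
        congr 1
        rw [hpow r]
        field_simp
      · rw [Set.indicator_of_notMem hm, Set.indicator_of_notMem hm, mul_zero]
  have hm1 : Measurable fun r : ℝ => 18 * (sphereModulus Ω (2 * ρ / r) * ENNReal.ofReal r⁻¹) :=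
    (((sphereModulus_mono Ω).measurable.comp
      (by fun_prop : Measurable fun r : ℝ => 2 * ρ / r)).mul (by fun_prop)).const_mul _
  rw [setLIntegral_congr_fun measurableSet_Ici e1, lintegral_add_left hm1,
    lintegral_add_left (by fun_prop)]
  refine add_le_add ?_ (add_le_add ?_ ?_)
  · rw [lintegral_const_mul' _ _ (by norm_num)]
    gcongr
    exact hΩ.setLIntegral_sphereModulus_le h2ρ
  · rw [lintegral_const_mul' _ _ ENNReal.ofReal_ne_top, setLIntegral_Ici_rpow h2ρ (by norm_num),
      ← ENNReal.ofReal_mul (by positivity)]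
    refine ENNReal.ofReal_le_ofReal ?_
    rw [show (-2 : ℝ) + 1 = -1 by norm_num, Real.rpow_neg_one]
    have : B₁ * profileLip n * ρ * ((2 * ρ)⁻¹ / - -1) = B₁ * profileLip n / 2 := by
      field_simp
    rw [this]
    have : 0 ≤ B₁ * profileLip n := by positivity
    linarith
  · refine (setLIntegral_le_lintegral _ _).trans ?_
    rw [lintegral_indicator measurableSet_Icc]
    calc ∫⁻ r in Set.Icc (2 * ε / 3) (2 * ε), ENNReal.ofReal (B₁ * (18 * 2 ^ n) / r)
        ≤ ∫⁻ _r in Set.Icc (2 * ε / 3) (2 * ε),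
            ENNReal.ofReal (B₁ * (18 * 2 ^ n) / (2 * ε / 3)) := by
          refine setLIntegral_mono' measurableSet_Icc fun r hr => ENNReal.ofReal_le_ofReal ?_
          have := hr.1
          gcongr
      _ = ENNReal.ofReal (B₁ * (36 * 2 ^ n)) := by
          rw [setLIntegral_const, Real.volume_Icc, ← ENNReal.ofReal_mul (by positivity)]
          congr 1
          field_simp
          ring

/-- The constant in Hörmander's condition for `truncKernel`. -/
noncomputable def hormanderConst (n : ℕ) (B₁ B₂ : ℝ) : ℝ≥0∞ :=
  n * volume (Metric.ball (0 : EuclideanSpace ℝ (Fin n)) 1) *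
    (18 * ENNReal.ofReal B₂ + (ENNReal.ofReal (B₁ * profileLip n) +
        ENNReal.ofReal (B₁ * (36 * 2 ^ n))))

theorem truncKernel_hormander (hΩ : IsDiniAngular B₁ B₂ Ω) (hχ : IsCutoff χ) (hβ : 0 < β)
    (hβ1 : β ≤ 1) (hB : 0 ≤ B₁) (hε : 0 < ε) (y : EuclideanSpace ℝ (Fin n)) :
    ∫⁻ x in {x | 2 * ‖y‖ ≤ ‖x‖}, ‖truncKernel Ω χ β ε (x - y) - truncKernel Ω χ β ε x‖ₑ ≤
      hormanderConst n B₁ B₂ := by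
  rcases eq_or_ne y 0 with rfl | hy
  · simp
  have hms : MeasurableSet {x : EuclideanSpace ℝ (Fin n) | 2 * ‖y‖ ≤ ‖x‖} :=
    measurableSet_le measurable_const measurable_norm
  have hy' : 0 < 2 * ‖y‖ := by have := norm_pos_iff.2 hy; linarith
  calc ∫⁻ x in {x | 2 * ‖y‖ ≤ ‖x‖}, ‖truncKernel Ω χ β ε (x - y) - truncKernel Ω χ β ε x‖ₑ
      ≤ ∫⁻ x in {x | 2 * ‖y‖ ≤ ‖x‖}, kernelDiffBound Ω B₁ ε ‖y‖ ‖x‖ :=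
        setLIntegral_mono' hms fun x hx => enorm_truncKernel_sub_le hΩ hχ hβ hβ1 hy hx
    _ = ∫⁻ x : EuclideanSpace ℝ (Fin n),
          (Set.Ici (2 * ‖y‖)).indicator (kernelDiffBound Ω B₁ ε ‖y‖) ‖x‖ := by
        rw [← lintegral_indicator hms]
        rfl
    _ = n * volume (Metric.ball (0 : EuclideanSpace ℝ (Fin n)) 1) *
          ∫⁻ r in Set.Ici (2 * ‖y‖), ENNReal.ofReal (r ^ (n - 1)) *
            kernelDiffBound Ω B₁ ε ‖y‖ r := by
        rw [lintegral_fun_norm ((measurable_kernelDiffBound _).indicator measurableSet_Ici)]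
        congr 1
        have : ∀ r, ENNReal.ofReal (r ^ (n - 1)) *
            (Set.Ici (2 * ‖y‖)).indicator (kernelDiffBound Ω B₁ ε ‖y‖) r =
            (Set.Ici (2 * ‖y‖)).indicator (fun r => ENNReal.ofReal (r ^ (n - 1)) *
              kernelDiffBound Ω B₁ ε ‖y‖ r) r := fun r => by
          by_cases hr : r ∈ Set.Ici (2 * ‖y‖) <;> simp [hr]
        simp_rw [this]
        rw [setLIntegral_indicator measurableSet_Ici,
          Set.inter_eq_left.2 (Set.Ici_subset_Ioi.2 hy')]
    _ ≤ hormanderConst n B₁ B₂ := by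
        rw [hormanderConst]
        gcongr
        exact setLIntegral_kernelDiffBound_le hΩ hB hε (norm_pos_iff.2 hy)

end TruncatedKernel

/-! ### The uniform bound for the Fourier transform. -/

section FourierBound

open FourierTransform

variable {n : ℕ} [NeZero n] {Ω : EuclideanSpace ℝ (Fin n) → ℝ} {χ : ℝ → ℝ} {B₁ B₂ β ε : ℝ}

theorem norm_fourierChar_sub_one_le (t : ℝ) :
    ‖((Real.fourierChar t : Circle) : ℂ) - 1‖ ≤ 2 * Real.pi * |t| := by
  rw [Real.fourierChar_apply, mul_comm]
  refine Real.norm_exp_I_mul_ofReal_sub_one_le.trans_eq ?_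
  rw [Real.norm_eq_abs, abs_mul, abs_of_pos Real.two_pi_pos]

/-- A kernel of mean value zero, supported in the ball of radius `R` and of size `C / |x| ^ n`,
has Fourier transform of size `C R |ξ|`. -/
theorem enorm_fourier_le_of_integral_eq_zero {k : EuclideanSpace ℝ (Fin n) → ℝ}
    (hk : Integrable k) (hk0 : ∫ x, k x = 0) {R C : ℝ}
    (hsupp : ∀ x, R ≤ ‖x‖ → k x = 0) (hsize : ∀ x, x ≠ 0 → |k x| ≤ C / ‖x‖ ^ n)
    (ξ : EuclideanSpace ℝ (Fin n)) :
    ‖𝓕 (fun x => (k x : ℂ)) ξ‖ₑ ≤ n * volume (Metric.ball (0 : EuclideanSpace ℝ (Fin n)) 1) *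
      (ENNReal.ofReal (2 * Real.pi * ‖ξ‖ * C) * ENNReal.ofReal R) := by
  have hkc : Integrable (fun x => (k x : ℂ)) := hk.ofReal
  -- Mean value zero allows `1` to be subtracted from the character, which gains the factor `‖x‖ *
  -- ‖ξ‖` and makes the size bound integrable at the origin.
  have h1 : 𝓕 (fun x => (k x : ℂ)) ξ =
      ∫ x, (((Real.fourierChar (-inner ℝ x ξ) : Circle) : ℂ) - 1) * (k x : ℂ) := by
    have h2 : Integrable fun x => ((Real.fourierChar (-inner ℝ x ξ) : Circle) : ℂ) * (k x : ℂ) := by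
      simpa only [Circle.smul_def, smul_eq_mul] using (Real.fourierIntegral_convergent_iff ξ).2 hkc
    simp_rw [sub_mul, one_mul]
    rw [integral_sub h2 hkc, integral_complex_ofReal, hk0, Complex.ofReal_zero, sub_zero,
      Real.fourier_eq]
    simp_rw [Circle.smul_def, smul_eq_mul]
  have h3 : ∀ x : EuclideanSpace ℝ (Fin n), x ≠ 0 →
      ‖(((Real.fourierChar (-inner ℝ x ξ) : Circle) : ℂ) - 1) * (k x : ℂ)‖ₑ ≤
      (Set.Iio R).indicator
        (fun r => ENNReal.ofReal (2 * Real.pi * ‖ξ‖ * C / r ^ (n - 1))) ‖x‖ := by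
    intro x hx
    have hx' : 0 < ‖x‖ := norm_pos_iff.2 hx
    rcases lt_or_ge ‖x‖ R with h | h
    · rw [Set.indicator_of_mem (by exact h), ← ofReal_norm]
      refine ENNReal.ofReal_le_ofReal ?_
      rw [norm_mul, Complex.norm_real]
      calc ‖((Real.fourierChar (-inner ℝ x ξ) : Circle) : ℂ) - 1‖ * ‖k x‖
          ≤ (2 * Real.pi * (‖x‖ * ‖ξ‖)) * (C / ‖x‖ ^ n) := by
            gcongr
            · refine (norm_fourierChar_sub_one_le _).trans ?_
              rw [abs_neg]
              gcongr
              exact abs_real_inner_le_norm x ξ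
            · exact hsize x hx
        _ = 2 * Real.pi * ‖ξ‖ * C / ‖x‖ ^ (n - 1) := by
            have : ‖x‖ ^ n = ‖x‖ * ‖x‖ ^ (n - 1) := by
              rw [← pow_succ', Nat.sub_add_cancel (Nat.pos_of_ne_zero (NeZero.ne n))]
            rw [this]
            field_simp
    · rw [hsupp x h]
      simp
  have := nontrivial_euclideanSpace_fin (n := n)
  rw [h1]
  refine (enorm_integral_le_lintegral_enorm _).trans ?_
  calc ∫⁻ x, ‖(((Real.fourierChar (-inner ℝ x ξ) : Circle) : ℂ) - 1) * (k x : ℂ)‖ₑ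
      ≤ ∫⁻ x : EuclideanSpace ℝ (Fin n), (Set.Iio R).indicator
        (fun r => ENNReal.ofReal (2 * Real.pi * ‖ξ‖ * C / r ^ (n - 1))) ‖x‖ := by
        refine lintegral_mono_ae ?_
        filter_upwards [compl_mem_ae_iff.2 (measure_singleton (0 : EuclideanSpace ℝ (Fin n)))]
          with x hx using h3 x hx
    _ = n * volume (Metric.ball (0 : EuclideanSpace ℝ (Fin n)) 1) *
          ∫⁻ r in Set.Ioi (0 : ℝ), ENNReal.ofReal (r ^ (n - 1)) * (Set.Iio R).indicator
            (fun r => ENNReal.ofReal (2 * Real.pi * ‖ξ‖ * C / r ^ (n - 1))) r :=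
        lintegral_fun_norm (Measurable.indicator (by fun_prop) measurableSet_Iio)
    _ = _ := by
        congr 1
        have h4 : ∀ r ∈ Set.Ioi (0 : ℝ), ENNReal.ofReal (r ^ (n - 1)) * (Set.Iio R).indicator
            (fun r => ENNReal.ofReal (2 * Real.pi * ‖ξ‖ * C / r ^ (n - 1))) r =
            (Set.Iio R).indicator (fun _ => ENNReal.ofReal (2 * Real.pi * ‖ξ‖ * C)) r := by
          intro r hr
          have hr' : 0 < r := hr
          by_cases hrR : r ∈ Set.Iio R
          · rw [Set.indicator_of_mem hrR, Set.indicator_of_mem hrR,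
              ← ENNReal.ofReal_mul (by positivity)]
            congr 1
            field_simp
          · rw [Set.indicator_of_notMem hrR, Set.indicator_of_notMem hrR, mul_zero]
        rw [setLIntegral_congr_fun measurableSet_Ioi h4, setLIntegral_indicator measurableSet_Iio,
          setLIntegral_const, Set.Iio_inter_Ioi, Real.volume_Ioo, sub_zero]

omit [NeZero n] in
/-- The Fourier transform at frequency `ξ` of a kernel that vanishes at distance less than
`1 / |ξ|` from the origin is controlled by Hörmander's condition. -/
theorem enorm_fourier_le_of_hormander {k : EuclideanSpace ℝ (Fin n) → ℝ}
    (hk : Integrable k) {ξ : EuclideanSpace ℝ (Fin n)} (hξ : ξ ≠ 0)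
    (hsupp : ∀ x, ‖x‖ < 1 / ‖ξ‖ → k x = 0) {C : ℝ} (hC : 0 ≤ C)
    (hsize : ∀ x, |k x| ≤ C / (1 / ‖ξ‖) ^ n)
    {H : ℝ≥0∞} (hH : ∀ y, ∫⁻ x in {x | 2 * ‖y‖ ≤ ‖x‖}, ‖k (x - y) - k x‖ₑ ≤ H) :
    ‖𝓕 (fun x => (k x : ℂ)) ξ‖ₑ ≤
      ENNReal.ofReal C * volume (Metric.ball (0 : EuclideanSpace ℝ (Fin n)) 1) + H := by
  have hkc : Integrable (fun x => (k x : ℂ)) := hk.ofReal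
  have hξ' : 0 < ‖ξ‖ := norm_pos_iff.2 hξ
  -- Translation by `z` shifts the phase by half a period. Moreover `2 * ‖z‖ = 1 / ‖ξ‖`, so the
  -- complement of Hörmander's region for `-z` is exactly the ball where `k` vanishes, and there
  -- only `k (x + z)` remains.
  set z : EuclideanSpace ℝ (Fin n) := (1 / (2 * ‖ξ‖ ^ 2) : ℝ) • ξ with hz
  have hznorm : 2 * ‖-z‖ = 1 / ‖ξ‖ := by
    rw [norm_neg, hz, norm_smul, Real.norm_eq_abs, abs_of_pos (by positivity)]
    field_simp
  have hms : MeasurableSet {x : EuclideanSpace ℝ (Fin n) | 2 * ‖-z‖ ≤ ‖x‖} :=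
    measurableSet_le measurable_const measurable_norm
  have hcompl : {x : EuclideanSpace ℝ (Fin n) | 2 * ‖-z‖ ≤ ‖x‖}ᶜ = Metric.ball 0 (1 / ‖ξ‖) := by
    ext x
    rw [hznorm]
    simp
  have h1 := fourierIntegral_eq_half_sub_half_period_translate hξ hkc
  rw [Real.fourier_eq, h1, enorm_smul]
  have hhalf : ‖(1 / 2 : ℂ)‖ₑ ≤ 1 := by
    rw [← ofReal_norm]
    simp only [one_div, norm_inv, Complex.norm_ofNat]
    rw [ENNReal.ofReal_le_one]
    norm_num
  refine (mul_le_of_le_one_left' hhalf).trans ((enorm_integral_le_lintegral_enorm _).trans ?_)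
  have h2 : ∀ x, ‖Real.fourierChar (-inner ℝ x ξ) • ((k x : ℂ) - (k (x + z) : ℂ))‖ₑ =
      ‖k (x - -z) - k x‖ₑ := by
    intro x
    rw [sub_neg_eq_add, ← ofReal_norm, ← ofReal_norm, Circle.norm_smul,
      ← Complex.ofReal_sub, Complex.norm_real, norm_sub_rev]
  simp_rw [← hz]
  rw [lintegral_congr h2, ← lintegral_add_compl _ hms, add_comm]
  refine add_le_add ?_ (hH _)
  rw [hcompl]
  calc ∫⁻ x in Metric.ball 0 (1 / ‖ξ‖), ‖k (x - -z) - k x‖ₑ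
      ≤ ∫⁻ _x in Metric.ball (0 : EuclideanSpace ℝ (Fin n)) (1 / ‖ξ‖),
          ENNReal.ofReal (C / (1 / ‖ξ‖) ^ n) := by
        refine setLIntegral_mono' Metric.isOpen_ball.measurableSet fun x hx => ?_
        rw [hsupp x (by simpa using hx), sub_zero, Real.enorm_eq_ofReal_abs]
        exact ENNReal.ofReal_le_ofReal (hsize _)
    _ = ENNReal.ofReal C * volume (Metric.ball (0 : EuclideanSpace ℝ (Fin n)) 1) := by
        rw [setLIntegral_const, Measure.addHaar_ball_of_pos _ _ (by positivity),
          finrank_euclideanSpace_fin, ← mul_assoc, ← ENNReal.ofReal_mul (by positivity)]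
        congr 2
        field_simp

/-- The constant of `truncKernel` as a Calderón–Zygmund kernel. -/
noncomputable def kernelConst (n : ℕ) (B₁ B₂ : ℝ) : ℝ≥0∞ :=
  n * volume (Metric.ball (0 : EuclideanSpace ℝ (Fin n)) 1) *
      ENNReal.ofReal (2 * Real.pi * (18 * B₁)) +
    (ENNReal.ofReal (18 * B₁) * volume (Metric.ball (0 : EuclideanSpace ℝ (Fin n)) 1) +
      hormanderConst n B₁ B₂)

omit [NeZero n] in
theorem kernelConst_ne_top : kernelConst n B₁ B₂ ≠ ⊤ := by
  have : volume (Metric.ball (0 : EuclideanSpace ℝ (Fin n)) 1) ≠ ⊤ := measure_ball_lt_top.ne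
  unfold kernelConst hormanderConst
  finiteness

/-- Cut at `R = 1 / ‖ξ‖`. The outer piece is again a truncated kernel, with `max ε R` in place of
`ε`, so it has the same Hörmander constant; the inner piece is still angular times radial, hence of
mean value zero. At `ξ = 0` the transform is the vanishing integral of the kernel. -/
theorem enorm_fourier_truncKernel_le (hΩ : IsDiniAngular B₁ B₂ Ω) (hχ : IsCutoff χ) (hβ : 0 < β)
    (hβ1 : β ≤ 1) (hB : 0 ≤ B₁) (hε : 0 < ε) (ξ : EuclideanSpace ℝ (Fin n)) :
    ‖𝓕 (fun x => (truncKernel Ω χ β ε x : ℂ)) ξ‖ₑ ≤ kernelConst n B₁ B₂ := by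
  rcases eq_or_ne ξ 0 with rfl | hξ
  · have h0 : ∫ x, truncKernel Ω χ β ε x = 0 := by
      simp_rw [truncKernel_eq]
      exact integral_angular_mul_radial_eq_zero hΩ.homogeneous hΩ.cancellation _
    rw [Real.fourier_eq]
    simp only [inner_zero_right, neg_zero, AddChar.map_zero_eq_one, one_smul]
    rw [integral_complex_ofReal, h0]
    simp
  have hξ' : 0 < ‖ξ‖ := norm_pos_iff.2 hξ
  set R := 1 / ‖ξ‖ with hR
  have hR0 : 0 < R := by positivity
  have hε' : 0 < max ε R := lt_max_of_lt_left hε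
  set kout := truncKernel Ω χ β (max ε R) with hkout
  set kin : EuclideanSpace ℝ (Fin n) → ℝ := fun x => truncKernel Ω χ β ε x - kout x with hkin
  have hiout : Integrable kout := integrable_truncKernel hB hΩ hχ hβ hβ1 hε'
  have hi : Integrable (truncKernel Ω χ β ε) := integrable_truncKernel hB hΩ hχ hβ hβ1 hε
  have hiin : Integrable kin := hi.sub hiout
  have hkin_eq : ∀ x, kin x = if ‖x‖ < R then truncKernel Ω χ β ε x else 0 := by
    intro x
    simp only [hkin, hkout, truncKernel_eq, truncProfile, max_le_iff]
    split_ifs with h1 h2 h3 h4 h5 h6 <;> first | (exfalso; grind) | simp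
  have hin := enorm_fourier_le_of_integral_eq_zero hiin (by
      have : ∀ x, kin x = Ω x * (truncProfile n χ β ε ‖x‖ - truncProfile n χ β (max ε R) ‖x‖) :=
        fun x => by simp only [hkin, hkout, truncKernel_eq]; ring
      simp_rw [this]
      exact integral_angular_mul_radial_eq_zero hΩ.homogeneous hΩ.cancellation
        (fun r => truncProfile n χ β ε r - truncProfile n χ β (max ε R) r))
    (R := R) (C := 18 * B₁)
    (fun x hx => by rw [hkin_eq, if_neg (not_lt.2 hx)])
    (fun x hx => by
      rw [hkin_eq]
      split_ifs
      · exact abs_truncKernel_le hΩ hχ hβ hβ1 hx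
      · rw [abs_zero]; positivity) ξ
  have hout := enorm_fourier_le_of_hormander hiout hξ
    (fun x hx => truncKernel_eq_zero (lt_max_of_lt_right hx)) (C := 18 * B₁) (by positivity)
    (fun x => (abs_truncKernel_le_const hB hΩ hχ hβ hβ1 hε' x).trans (by
      have : R ≤ max ε R := le_max_right _ _
      gcongr))
    (truncKernel_hormander hΩ hχ hβ hβ1 hB hε')
  have hadd : 𝓕 (fun x => (truncKernel Ω χ β ε x : ℂ)) ξ =
      𝓕 (fun x => (kin x : ℂ)) ξ + 𝓕 (fun x => (kout x : ℂ)) ξ := by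
    have hc1 : Integrable (fun x => (kin x : ℂ)) := hiin.ofReal
    have hc2 : Integrable (fun x => (kout x : ℂ)) := hiout.ofReal
    rw [Real.fourier_eq, Real.fourier_eq, Real.fourier_eq, ← integral_add
      ((Real.fourierIntegral_convergent_iff ξ).2 hc1)
      ((Real.fourierIntegral_convergent_iff ξ).2 hc2)]
    refine integral_congr_ae (Filter.Eventually.of_forall fun x => ?_)
    simp only [hkin]
    rw [← smul_add]
    push_cast
    rw [sub_add_cancel]
  rw [hadd]
  refine (enorm_add_le _ _).trans (add_le_add (hin.trans_eq ?_) hout)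
  rw [← ENNReal.ofReal_mul (by positivity)]
  congr 2
  rw [hR]
  field_simp

theorem isCZKernel_truncKernel (hΩ : IsDiniAngular B₁ B₂ Ω) (hχ : IsCutoff χ) (hβ : 0 < β)
    (hβ1 : β ≤ 1) (hB : 0 ≤ B₁) (hε : 0 < ε) :
    IsCZKernel (kernelConst n B₁ B₂).toNNReal (truncKernel Ω χ β ε) where
  measurable := measurable_truncKernel hΩ hχ hε
  integrable := integrable_truncKernel hB hΩ hχ hβ hβ1 hε
  bounded := ⟨_, abs_truncKernel_le_const hB hΩ hχ hβ hβ1 hε⟩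
  fourier_le ξ := by
    have h := enorm_fourier_truncKernel_le hΩ hχ hβ hβ1 hB hε ξ
    rw [← ENNReal.coe_toNNReal (kernelConst_ne_top (n := n)), enorm_eq_nnnorm,
      ENNReal.coe_le_coe] at h
    exact h
  hormander y := by
    rw [ENNReal.coe_toNNReal kernelConst_ne_top]
    refine (truncKernel_hormander hΩ hχ hβ hβ1 hB hε y).trans ?_
    unfold kernelConst
    exact le_add_left (le_add_left le_rfl)

end FourierBound

/-! ### The main theorem. -/

theorem nearPart_eq_realConv {n : ℕ} (Ω : EuclideanSpace ℝ (Fin n) → ℝ) (χ : ℝ → ℝ) (β ε : ℝ)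
    (f : EuclideanSpace ℝ (Fin n) → ℝ) :
    nearPart Ω χ β ε f = realConv (truncKernel Ω χ β ε) f := by
  ext x
  rw [nearPart, realConv, ← integral_indicator (measurableSet_le measurable_const measurable_norm)]
  refine integral_congr_ae (Filter.Eventually.of_forall fun y => ?_)
  by_cases hy : ε ≤ ‖y‖ <;> simp [truncKernel, hy]

theorem theorem2p3 (n : ℕ) (hn : 1 ≤ n) (q : ℝ≥0∞) (hq : 1 < q) (hq' : q < ⊤)
    (B₁ B₂ : ℝ) (hB₁ : 0 < B₁) (hB₂ : 0 < B₂)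
    (β₀ : ℝ) (hβ₀ : 0 < β₀) (hβ₀' : β₀ < 1 / 2) :
    ∃ C : ℝ≥0,
      ∀ Ω : EuclideanSpace ℝ (Fin n) → ℝ, IsDiniAngular B₁ B₂ Ω →
      ∀ χ : ℝ → ℝ, IsCutoff χ →
      ∀ β : ℝ, 0 < β → β ≤ 1 - β₀ →
      ∀ ε : ℝ, 0 < ε →
      ∀ f : EuclideanSpace ℝ (Fin n) → ℝ, MemLp f 1 volume → MemLp f q volume →
        (∀ x, IntegrableOn (fun y => nearKernel Ω χ β y * f (x - y)) {y | ε ≤ ‖y‖} volume) ∧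
        MemLp (nearPart Ω χ β ε f) q volume ∧
        eLpNorm (nearPart Ω χ β ε f) q volume ≤ C * eLpNorm f q volume := by
  have : NeZero n := ⟨by omega⟩
  -- The constant is fixed before `Ω`, `χ`, `β`, `ε` and `f` are introduced.
  obtain ⟨C, hC⟩ := exists_eLpNorm_realConv_le (n := n) (kernelConst n B₁ B₂).toNNReal hq hq'
  refine ⟨C, fun Ω hΩ χ hχ β hβ hβ1 ε hε f hf1 hfq => ?_⟩
  have hK := isCZKernel_truncKernel hΩ hχ hβ (by linarith) hB₁.le hε
  have hf := memLp_one_iff_integrable.1 hf1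
  obtain ⟨M, hM⟩ := hK.bounded
  rw [nearPart_eq_realConv]
  refine ⟨fun x => ?_, memLp_realConv hK.integrable hM hf hq.le hq'.ne, hC _ hK f hf hfq⟩
  rw [← integrable_indicator_iff (measurableSet_le measurable_const measurable_norm)]
  refine (integrable_realConv_integrand hK.measurable hM hf x).congr
    (Filter.Eventually.of_forall fun y => ?_)
  by_cases hy : ε ≤ ‖y‖ <;> simp [truncKernel, hy]
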